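/- Definitions. Let $\mathscr G$ be a permutation group on a set $B$ and $k\ge 3$. Call $\mathscr G$ *$k$-neoliberal* if (a) for every $n$ it has only finitely many orbits of $n$-tuples; (b) it has at most one orbit of injective $(k-1)$-tuples; (c) for every $\ell\ge k$, the orbit of an $\ell$-tuple is determined by the orbits of its $k$-subtuples; (d) for all (not necessarily distinct) $a_1,\dots,a_{k-1}\in B$, the pointwise stabilizer of $a_1,\dots,a_{k-1}$ in $\mathscr G$ fixes no element of $B\setminus\{a_1,\dots,a_{k-1}\}$. A relational structure $\mathbb B$ on $B$ is *$k$-neoliberal* if, for some $k$-neoliberal $\mathscr G$, it has exactly one relation for every orbit of injective $k$-tuples under $\mathscr G$, and no other relations. A structure $\mathbb B$ in a finite relational signature $\tau$ is *finitely bounded* if there is a finite set $\mathcal F$ of finite $\tau$-structures such that a finite $\tau$-structure embeds into $\mathbb B$ if and only if no member of $\mathcal F$ embeds into it; $b_{\mathbb B}$ is the smallest possible value, over all such $\mathcal F$, of the size of the largest member of $\mathcal F$. It has *finite duality* if it is finitely bounded and there is a finite set $\mathcal F'$ of finite $\tau$-structures such that a finite $\tau$-structure maps homomorphically to $\mathbb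 B$ if and only if no member of $\mathcal F'$ maps homomorphically to it. A *first-order expansion* of $\mathbb B$ is an expansion of $\mathbb B$ by relations that are first-order definable in $\mathbb B$ without parameters. Let $\mathbb A$ be a relational structure on $A$ whose relations have bounded arity. A *constraint* on a finite set $V$ of variables with non-empty scope $U\subseteq V$ is a set $C\subseteq A^U$; an *instance* is a finite set of constraints on $V$. It is *over* a set $\Gamma$ of relations if each of its constraints has the form $\{f\in A^U : (f(u_1),\dots,f(u_n))\in R\}$ with $R\in\Gamma$ and an enumeration $u_1,\dots,u_n$ of the scope $U$ (repetitions allowed). A *solution* is a map $V\to A$ whose restriction to every scope lies in the constraint. An instance is *non-trivial* if no constraint is empty, and *$(k,\ell)$-minimal* if every non-empty tuple of at most $\ell$ variables is contained in the scope of a constraint, and any two constraints whose scopes contain a given non-empty tuple of at most $k$ variables have the same projection onto this tuple. For $1\le k\le\ell$, a *$(k,\ell)$-minimal instance for $\mathbb A$* is a $(k,\ell)$-minimal instance over the primitively positively definable relations of $\mathbb A$ of arity at most the maximum of $\ell$ and the maximal arity of the relations of $\mathbb A$, which has the same variables and the same solutions as some instance over the relations of $\mathbb A$. The structure $\mathbb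 A$ has *relational width $(k,\ell)$* if every non-trivial $(k,\ell)$-minimal instance for $\mathbb A$ has a solution. It has *bounded strict width* if there are $m\ge1$ and $\ell>m$ such that for every $(m,\ell)$-minimal instance for $\mathbb A$, every map $g\colon U\to A$ with $U\subseteq V$ such that for every constraint $C$ with scope $W$ the map $g|_{U\cap W}$ extends to a member of $C$, extends to a solution. Statement. Let $k\ge3$, let $\mathbb B$ be a $k$-neoliberal structure with finite duality, and let $\mathbb A$ be a first-order expansion of $\mathbb B$ whose relations have bounded arity. If $\mathbb A$ has bounded strict width, then $\mathbb A$ has relational width $(k,\max(k+1,b_{\mathbb B}))$. -/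

import Mathlib

open scoped FirstOrder

universe u v u' v' w

/-! ### Permutation groups -/

/-- The permutation group `G` is oligomorphic: for every `n`, it has only finitely many orbits of
`n`-tuples. -/
def IsOligomorphic {B : Type w} (G : Subgroup (Equiv.Perm B)) : Prop :=
  ∀ n : ℕ, Finite (MulAction.orbitRel.Quotient G (Fin n → B))

/-- `G` is `k`-homogeneous: for every `l ≥ k`, the orbit of an `l`-tuple is determined by the orbits
of its `k`-subtuples. -/
def IsHomogeneousGroup {B : Type w} (k : ℕ) (G : Subgroup (Equiv.Perm B)) : Prop :=
  ∀ l : ℕ, k ≤ l → ∀ a b : Fin l → B,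
    (∀ i : Fin k ↪o Fin l, a ∘ i ∈ MulAction.orbit G (b ∘ i)) → a ∈ MulAction.orbit G b

/-- `G` has no `k`-algebraicity: the only fixed points of the pointwise stabilizer of `k - 1`
elements are these elements themselves. -/
def HasNoAlgebraicity {B : Type w} (k : ℕ) (G : Subgroup (Equiv.Perm B)) : Prop :=
  ∀ a : Fin (k - 1) → B, ∀ b : B,
    (∀ g ∈ G, (∀ i, g (a i) = a i) → g b = b) → b ∈ Set.range a

/-- `k`-neoliberal permutation groups. -/
structure IsNeoliberalGroup {B : Type w} (k : ℕ) (G : Subgroup (Equiv.Perm B)) : Prop where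
  oligomorphic : IsOligomorphic G
  transitive : MulAction.IsMultiplyPretransitive G B (k - 1)
  homogeneous : IsHomogeneousGroup k G
  noAlgebraicity : HasNoAlgebraicity k G

/-! ### Relational structures -/

/-- The relation that the symbol `R` denotes in the structure `A`. -/
def relOf {L : FirstOrder.Language.{u, v}} (A : Type w) [L.Structure A] {n : ℕ} (R : L.Relations n) :
    Set (Fin n → A) :=
  {x | FirstOrder.Language.Structure.RelMap R x}

/-- `B` is the canonical `k`-ary structure of `G`: all relation symbols are `k`-ary, and they name,
without repetition, exactly the orbits of injective `k`-tuples under `G`. -/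
structure IsCanonicalStructure (L : FirstOrder.Language.{u, v}) (B : Type w) [L.Structure B] (k : ℕ)
    (G : Subgroup (Equiv.Perm B)) : Prop where
  arity : ∀ n : ℕ, n ≠ k → IsEmpty (L.Relations n)
  isOrbit : ∀ R : L.Relations k, ∃ a : Fin k → B, Function.Injective a ∧
    relOf B R = MulAction.orbit G a
  named : ∀ a : Fin k → B, Function.Injective a →
    ∃! R : L.Relations k, relOf B R = MulAction.orbit G a

/-- `k`-neoliberal structures. -/
def IsNeoliberal (L : FirstOrder.Language.{u, v}) (B : Type w) [L.Structure B] (k : ℕ) : Prop :=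
  ∃ G : Subgroup (Equiv.Perm B), IsNeoliberalGroup k G ∧ IsCanonicalStructure L B k G

/-- Finite structures, up to isomorphism: the structures with domain `Fin n` for some `n`. -/
abbrev FinStructure (L : FirstOrder.Language.{u, v}) : Type (max u v) :=
  Σ n : ℕ, L.Structure (Fin n)

/-- The domain `Fin n` of a finite structure. -/
def FinStructure.Carrier {L : FirstOrder.Language.{u, v}} (X : FinStructure L) : Type := Fin X.1

instance FinStructure.instStructure {L : FirstOrder.Language.{u, v}} (X : FinStructure L) :
    L.Structure X.Carrier := X.2

/-- `F` is a set of bounds for `B`: a finite structure embeds into `B` if and only if no member of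
`F` embeds into it. -/
def IsBoundSet {L : FirstOrder.Language.{u, v}} (F : Set (FinStructure L)) (B : Type w) [L.Structure B] :
    Prop :=
  ∀ X : FinStructure L, Nonempty (X.Carrier ↪[L] B) ↔ ∀ Y ∈ F, IsEmpty (Y.Carrier ↪[L] X.Carrier)

/-- `F` is a set of obstructions for `B`: a finite structure maps homomorphically to `B` if and only
if no member of `F` maps homomorphically to it. -/
def IsObstructionSet {L : FirstOrder.Language.{u, v}} (F : Set (FinStructure L)) (B : Type w)
    [L.Structure B] : Prop :=
  ∀ X : FinStructure L, Nonempty (X.Carrier →[L] B) ↔ ∀ Y ∈ F, IsEmpty (Y.Carrier →[L] X.Carrier)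

/-- `B` is finitely bounded. -/
def IsFinitelyBounded (L : FirstOrder.Language.{u, v}) (B : Type w) [L.Structure B] : Prop :=
  ∃ F : Set (FinStructure L), F.Finite ∧ IsBoundSet F B

/-- `B` is finitely bounded and has a finite set of homomorphism obstructions. -/
def HasFiniteDuality (L : FirstOrder.Language.{u, v}) (B : Type w) [L.Structure B] : Prop :=
  IsFinitelyBounded L B ∧ ∃ F : Set (FinStructure L), F.Finite ∧ IsObstructionSet F B

/-- The size of the largest bound of `B`, for a finite set of bounds that makes it as small as
possible. -/
noncomputable def boundSize (L : FirstOrder.Language.{u, v}) (B : Type w) [L.Structure B] : ℕ :=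
  sInf {b : ℕ | ∃ F : Set (FinStructure L), F.Finite ∧ IsBoundSet F B ∧ ∀ Y ∈ F, Y.1 ≤ b}

/-- The `L'`-structure on `B` is an expansion of the `L`-structure on `B` by relations that are
first-order definable (without parameters) in the latter. -/
def IsFirstOrderExpansion (L : FirstOrder.Language.{u, v}) (L' : FirstOrder.Language.{u', v'}) (B : Type w)
    [L.Structure B] [L'.Structure B] : Prop :=
  (∃ e : L →ᴸ L', e.IsExpansionOn B) ∧
    ∀ (n : ℕ) (R : L'.Relations n), (∅ : Set B).Definable L (relOf B R)

/-- The arities of the relation symbols of `L` are bounded. -/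
def HasBoundedArity (L : FirstOrder.Language.{u, v}) : Prop :=
  ∃ N : ℕ, ∀ n : ℕ, N < n → IsEmpty (L.Relations n)

/-- Primitive positive formulas: built from atomic formulas by conjunction and existential
quantification. -/
inductive IsPrimitivePositive {L : FirstOrder.Language.{u, v}} {α : Type} :
    ∀ {n : ℕ}, L.BoundedFormula α n → Prop
  | atomic {n : ℕ} {φ : L.BoundedFormula α n} (h : φ.IsAtomic) : IsPrimitivePositive φ
  | conj {n : ℕ} {φ ψ : L.BoundedFormula α n} (hφ : IsPrimitivePositive φ)
      (hψ : IsPrimitivePositive ψ) : IsPrimitivePositive (φ ⊓ ψ)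
  | exist {n : ℕ} {φ : L.BoundedFormula α (n + 1)} (h : IsPrimitivePositive φ) :
      IsPrimitivePositive φ.ex

/-- The relation `S` is primitively positively definable in the `L`-structure `A`. -/
def IsPPDefinable (L : FirstOrder.Language.{u, v}) {A : Type w} [L.Structure A] {n : ℕ}
    (S : Set (Fin n → A)) : Prop :=
  ∃ φ : L.Formula (Fin n), IsPrimitivePositive φ ∧ S = {x | φ.Realize x}

/-! ### Constraint satisfaction problems -/

/-- A constraint with non-empty scope `U ⊆ V`: a set of maps `U → A`. -/
structure CSPConstraint (V : Type) (A : Type w) where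
  scope : Set V
  scope_nonempty : scope.Nonempty
  rel : Set (scope → A)

/-- The projection of a constraint onto a tuple of variables of its scope. -/
def CSPConstraint.proj {V : Type} {A : Type w} (C : CSPConstraint V A) {m : ℕ}
    (t : Fin m → C.scope) : Set (Fin m → A) :=
  (fun f => f ∘ t) '' C.rel

/-- An instance with variables from `V`: a finite set of constraints. -/
structure CSPInstance (V : Type) (A : Type w) where
  constraints : Set (CSPConstraint V A)
  finite : constraints.Finite

/-- A family of relations of all arities on `A`, as a template. -/
abbrev RelFamily (A : Type w) : Type w := ∀ n : ℕ, Set (Set (Fin n → A))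

/-- The relations of the structure `A`. -/
def structureRels (L : FirstOrder.Language.{u, v}) (A : Type w) [L.Structure A] : RelFamily A :=
  fun n => {S | ∃ R : L.Relations n, S = relOf A R}

/-- The relations that are primitively positively definable in `A` and whose arity is at most the
maximum of `l` and the maximal arity of the relations of `A`. -/
def ppRels (L : FirstOrder.Language.{u, v}) (A : Type w) [L.Structure A] (l : ℕ) : RelFamily A :=
  fun n => {S | (n ≤ l ∨ ∃ m : ℕ, n ≤ m ∧ Nonempty (L.Relations m)) ∧ IsPPDefinable L S}

namespace CSPInstance

variable {V : Type} {A : Type w}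

/-- Every constraint of `I` is a relation from `Γ`, for some enumeration of its scope. -/
def IsOver (Γ : RelFamily A) (I : CSPInstance V A) : Prop :=
  ∀ C ∈ I.constraints, ∃ (n : ℕ) (t : Fin n → C.scope), Function.Surjective t ∧
    ∃ S ∈ Γ n, ∀ f : C.scope → A, f ∈ C.rel ↔ f ∘ t ∈ S

/-- `f` is a solution of `I`. -/
def IsSolution (I : CSPInstance V A) (f : V → A) : Prop :=
  ∀ C ∈ I.constraints, (fun x : C.scope => f x) ∈ C.rel

/-- `I` and `J` have the same solutions. -/
def Equivalent (I J : CSPInstance V A) : Prop :=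
  ∀ f : V → A, I.IsSolution f ↔ J.IsSolution f

/-- No constraint of `I` is empty. -/
def IsNontrivial (I : CSPInstance V A) : Prop :=
  ∀ C ∈ I.constraints, C.rel.Nonempty

/-- `(k, l)`-minimal instances. -/
structure IsMinimal (k l : ℕ) (I : CSPInstance V A) : Prop where
  covered : ∀ m : ℕ, 1 ≤ m → m ≤ l → ∀ t : Fin m → V,
    ∃ C ∈ I.constraints, ∀ i, t i ∈ C.scope
  coincide : ∀ m : ℕ, 1 ≤ m → m ≤ k → ∀ t : Fin m → V,
    ∀ C₁ ∈ I.constraints, ∀ C₂ ∈ I.constraints,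
    ∀ (h₁ : ∀ i, t i ∈ C₁.scope) (h₂ : ∀ i, t i ∈ C₂.scope),
      C₁.proj (fun i => ⟨t i, h₁ i⟩) = C₂.proj (fun i => ⟨t i, h₂ i⟩)

/-- The partial assignment `g` on `U` is consistent with every constraint of `I`: its restriction to
the scope of the constraint extends to a member of the constraint. -/
def IsConsistent (I : CSPInstance V A) (U : Set V) (g : U → A) : Prop :=
  ∀ C ∈ I.constraints, ∃ f ∈ C.rel, ∀ (x : V) (hU : x ∈ U) (hC : x ∈ C.scope),
    f ⟨x, hC⟩ = g ⟨x, hU⟩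

end CSPInstance

/-- `I` is a `(k, l)`-minimal instance over the primitively positively definable relations of `A` of
the relevant arities, and it is equivalent to an instance of the CSP of `A`. -/
def IsMinimalInstanceOf (L : FirstOrder.Language.{u, v}) {A : Type w} [L.Structure A] (k l : ℕ) {V : Type}
    (I : CSPInstance V A) : Prop :=
  I.IsOver (ppRels L A l) ∧ I.IsMinimal k l ∧
    ∃ J : CSPInstance V A, J.IsOver (structureRels L A) ∧ I.Equivalent J

/-- `A` has relational width `(k, l)`. -/
def HasRelationalWidth (L : FirstOrder.Language.{u, v}) (A : Type w) [L.Structure A] (k l : ℕ) : Prop :=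
  ∀ (V : Type) [Finite V] (I : CSPInstance V A), IsMinimalInstanceOf L k l I →
    I.IsNontrivial → ∃ f : V → A, I.IsSolution f

/-- `A` has strict width `k`. -/
def HasStrictWidth (L : FirstOrder.Language.{u, v}) (A : Type w) [L.Structure A] (k : ℕ) : Prop :=
  ∃ l : ℕ, k < l ∧ ∀ (V : Type) [Finite V] (I : CSPInstance V A), IsMinimalInstanceOf L k l I →
    ∀ (U : Set V) (g : U → A), I.IsConsistent U g →
      ∃ f : V → A, I.IsSolution f ∧ ∀ x : U, f x = g x

/-- `A` has bounded strict width. -/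
def HasBoundedStrictWidth (L : FirstOrder.Language.{u, v}) (A : Type w) [L.Structure A] : Prop :=
  ∃ k : ℕ, 1 ≤ k ∧ HasStrictWidth L A k

/-! Bounded strict width makes all primitive positive relations of the template decomposable: for
some fixed `N` they are determined by their projections to `N` coordinates
(`HasStrictWidth.exists_isDecomposable`). Every later contradiction comes from one gadget,
`IsDecomposable.false_of_propagates`. A relation that carries membership in `C` from an input to an
output once the values on `Y` are prescribed, but may leave `C` when they are not, can be composed
`N + 1` times. Any `N` coordinates miss `Y` in some copy, where the chain may leave `C`, so the
composition is not decomposable.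

The first use concerns equalities. An orbit condition on `k` distinct values never forces a new
equality (`eq_of_implies`), so non-empty relations have members without avoidable equalities, even
with an injective `k`-tuple of values prescribed. After identifying variables that are entailed to
be equal, a non-trivial minimal instance therefore yields a system of injective constraints whose
projections to `k`-sets still agree (`IsInjectiveSystem`).

The second use concerns implications between proper restrictions on `k`-sets of variables. By
oligomorphy, a cycle of implications can be followed forwards inside the restriction and backwards
outside it until an orbit recurs. Finite duality allows long chains of this kind to be rerouted so
that their two ends are independent except on variables that never disappear (`Chain.connect`). With
the transitivity and the lack of algebraicity of the group this gives the gadget, so no cycle visits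
two different `k`-sets (`no_implication_cycle`).

Since there are finitely many restrictions up to orbits, some proper restriction is a sink: imposing
it changes no projection to another `k`-set (`exists_sink`). Imposing sinks repeatedly leaves a
system that fixes the orbit of every `k`-tuple inside a scope. The finite structure described by
these orbits contains no bound, because a bound would fit into one scope. Hence it embeds into the
base structure, and homogeneity turns the embedding into a solution. -/

/-! ### Primitive positive relations over arbitrary index types -/

/-- Atomic constraints on the variables `W`. -/
inductive PPAtom (L : FirstOrder.Language.{u, v}) (W : Type) : Type (max u v)
  | rel {n : ℕ} (R : L.Relations n) (t : Fin n → W) : PPAtom L W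
  | eq (x y : W) : PPAtom L W

namespace PPAtom

variable {L : FirstOrder.Language.{u, v}} {A : Type w} [L.Structure A] {W W' : Type}

/-- The assignment `f` satisfies the atom. -/
def Holds (f : W → A) : PPAtom L W → Prop
  | rel R t => f ∘ t ∈ relOf A R
  | eq x y => f x = f y

/-- Renaming of variables. -/
def map (r : W → W') : PPAtom L W → PPAtom L W'
  | rel R t => rel R (r ∘ t)
  | eq x y => eq (r x) (r y)

theorem holds_map (r : W → W') (f : W' → A) (a : PPAtom L W) :
    (a.map r).Holds f ↔ a.Holds (f ∘ r) := by
  cases a <;> rfl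

end PPAtom

/-- The relation `T` with coordinates `F` is the projection of a finite conjunction of atoms. -/
def IsPP (L : FirstOrder.Language.{u, v}) {A : Type w} [L.Structure A] {F : Type}
    (T : Set (F → A)) : Prop :=
  ∃ (H : Type) (_ : Finite H) (l : List (PPAtom L (F ⊕ H))),
    T = {g | ∃ h : H → A, ∀ a ∈ l, a.Holds (Sum.elim g h)}

namespace IsPP

variable {L : FirstOrder.Language.{u, v}} {A : Type w} [L.Structure A] {F F' : Type}

theorem of_atoms (l : List (PPAtom L F)) : IsPP L {g : F → A | ∀ a ∈ l, a.Holds g} := by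
  refine ⟨Empty, inferInstance, l.map (PPAtom.map Sum.inl), ?_⟩
  ext g
  simp [PPAtom.holds_map]

theorem univ : IsPP L (Set.univ : Set (F → A)) := by
  simpa using of_atoms (A := A) ([] : List (PPAtom L F))

theorem eq (x y : F) : IsPP L {g : F → A | g x = g y} := by
  simpa [PPAtom.Holds] using of_atoms (A := A) [(PPAtom.eq x y : PPAtom L F)]

theorem rel {n : ℕ} (R : L.Relations n) (t : Fin n → F) :
    IsPP L {g : F → A | g ∘ t ∈ relOf A R} := by
  simpa [PPAtom.Holds] using of_atoms (A := A) [(PPAtom.rel R t : PPAtom L F)]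

theorem inter {S T : Set (F → A)} (hS : IsPP L S) (hT : IsPP L T) : IsPP L (S ∩ T) := by
  obtain ⟨H₁, _, l₁, rfl⟩ := hS
  obtain ⟨H₂, _, l₂, rfl⟩ := hT
  refine ⟨H₁ ⊕ H₂, inferInstance, l₁.map (PPAtom.map (Sum.map id Sum.inl)) ++
    l₂.map (PPAtom.map (Sum.map id Sum.inr)), ?_⟩
  ext g
  have e₁ : ∀ h : H₁ ⊕ H₂ → A, Sum.elim g h ∘ Sum.map id Sum.inl = Sum.elim g (h ∘ Sum.inl) := by
    intro h; ext x; cases x <;> rfl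
  have e₂ : ∀ h : H₁ ⊕ H₂ → A, Sum.elim g h ∘ Sum.map id Sum.inr = Sum.elim g (h ∘ Sum.inr) := by
    intro h; ext x; cases x <;> rfl
  constructor
  · rintro ⟨⟨h₁, hh₁⟩, ⟨h₂, hh₂⟩⟩
    refine ⟨Sum.elim h₁ h₂, fun a ha => ?_⟩
    rcases List.mem_append.1 ha with ha | ha
    · obtain ⟨b, hb, rfl⟩ := List.mem_map.1 ha
      rw [PPAtom.holds_map, e₁]
      exact hh₁ b hb
    · obtain ⟨b, hb, rfl⟩ := List.mem_map.1 ha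
      rw [PPAtom.holds_map, e₂]
      exact hh₂ b hb
  · rintro ⟨h, hh⟩
    refine ⟨⟨h ∘ Sum.inl, fun a ha => ?_⟩, ⟨h ∘ Sum.inr, fun a ha => ?_⟩⟩
    · rw [← e₁, ← PPAtom.holds_map]
      exact hh _ (List.mem_append_left _ (List.mem_map_of_mem ha))
    · rw [← e₂, ← PPAtom.holds_map]
      exact hh _ (List.mem_append_right _ (List.mem_map_of_mem ha))

theorem reindex {T : Set (F → A)} (hT : IsPP L T) (r : F → F') :
    IsPP L {g : F' → A | g ∘ r ∈ T} := by
  obtain ⟨H, _, l, rfl⟩ := hT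
  refine ⟨H, inferInstance, l.map (PPAtom.map (Sum.map r id)), ?_⟩
  ext g
  have e : ∀ h : H → A, Sum.elim g h ∘ Sum.map r id = Sum.elim (g ∘ r) h := by
    intro h; ext x; cases x <;> rfl
  simp [PPAtom.holds_map, e]

theorem finset_iInter {ι : Type*} (s : Finset ι) {T : ι → Set (F → A)}
    (hT : ∀ i ∈ s, IsPP L (T i)) : IsPP L {g | ∀ i ∈ s, g ∈ T i} := by
  classical
  induction s using Finset.induction_on with
  | empty => simpa using univ
  | insert a s _ ih =>
    have := (hT a (Finset.mem_insert_self a s)).inter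
      (ih fun i hi => hT i (Finset.mem_insert_of_mem hi))
    convert this using 1
    ext g
    simp

theorem iInter {ι : Type*} [Finite ι] {T : ι → Set (F → A)} (hT : ∀ i, IsPP L (T i)) :
    IsPP L {g | ∀ i, g ∈ T i} := by
  have := Fintype.ofFinite ι
  simpa using finset_iInter Finset.univ fun i _ => hT i

theorem image [Finite F] [Finite F'] {T : Set (F → A)} (hT : IsPP L T) (r : F' → F) :
    IsPP L {g : F' → A | ∃ f ∈ T, g = f ∘ r} := by
  have h₁ : IsPP L {g : F' ⊕ F → A | g ∘ Sum.inr ∈ T ∧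
      ∀ x, g ∈ {g : F' ⊕ F → A | g (Sum.inl x) = g (Sum.inr (r x))}} :=
    (hT.reindex Sum.inr).inter (iInter fun x => eq _ _)
  obtain ⟨H, _, l, hl⟩ := h₁
  refine ⟨F ⊕ H, inferInstance, l.map (PPAtom.map (Equiv.sumAssoc _ _ _)), ?_⟩
  have hl' := fun g => Set.ext_iff.1 hl g
  have e : ∀ (g : F' → A) (h : F ⊕ H → A), Sum.elim g h ∘ (Equiv.sumAssoc F' F H) =
      Sum.elim (Sum.elim g (h ∘ Sum.inl)) (h ∘ Sum.inr) := by
    intro g h; ext x; rcases x with (x | x) | x <;> rfl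
  ext g
  constructor
  · rintro ⟨f, hf, rfl⟩
    obtain ⟨h, hh⟩ := (hl' (Sum.elim (f ∘ r) f)).1 ⟨hf, fun x => rfl⟩
    refine ⟨Sum.elim f h, fun a ha => ?_⟩
    obtain ⟨b, hb, rfl⟩ := List.mem_map.1 ha
    rw [PPAtom.holds_map, e]
    exact hh b hb
  · rintro ⟨h, hh⟩
    obtain ⟨h₁, h₂⟩ := (hl' (Sum.elim g (h ∘ Sum.inl))).2 ⟨h ∘ Sum.inr, fun a ha => by
      rw [← e, ← PPAtom.holds_map]
      exact hh _ (List.mem_map_of_mem ha)⟩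
    exact ⟨h ∘ Sum.inl, h₁, funext h₂⟩

/-- Primitive positive relations are invariant under permutations that preserve all relations. -/
theorem smul_mem {G : Subgroup (Equiv.Perm A)}
    (hG : ∀ (n : ℕ) (R : L.Relations n), ∀ g ∈ G, ∀ f ∈ relOf A R, (g ∘ f : Fin n → A) ∈ relOf A R)
    {T : Set (F → A)} (hT : IsPP L T) {g : Equiv.Perm A} (hg : g ∈ G) {f : F → A} (hf : f ∈ T) :
    g ∘ f ∈ T := by
  obtain ⟨H, _, l, rfl⟩ := hT
  obtain ⟨h, hh⟩ := hf
  refine ⟨g ∘ h, fun a ha => ?_⟩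
  have h1 := hh a ha
  rw [← Sum.comp_elim]
  cases a with
  | rel R t => exact hG _ R g hg _ h1
  | eq x y => exact congrArg g h1

open FirstOrder.Language in
-- In a relational language all terms are variables, so atomic formulas are exactly the atoms of
-- `PPAtom`. Conjunction and quantification correspond to intersection and to forgetting the last
-- coordinate.
theorem of_boundedFormula [L.IsRelational] {α : Type} [Finite α] {n : ℕ} {φ : L.BoundedFormula α n}
    (hφ : IsPrimitivePositive φ) :
    IsPP L {x : α ⊕ Fin n → A | φ.Realize (x ∘ Sum.inl) (x ∘ Sum.inr)} := by
  have hterm : ∀ {m : ℕ} (t : L.Term (α ⊕ Fin m)), ∃ x, t = Term.var x := by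
    intro m t
    cases t with
    | var x => exact ⟨x, rfl⟩
    | func f => exact isEmptyElim f
  have hval : ∀ {m : ℕ} (x : α ⊕ Fin m → A), Sum.elim (x ∘ Sum.inl) (x ∘ Sum.inr) = x := by
    intro m x; ext y; cases y <;> rfl
  induction hφ with
  | atomic h =>
    cases h with
    | equal t₁ t₂ =>
      obtain ⟨x, rfl⟩ := hterm t₁
      obtain ⟨y, rfl⟩ := hterm t₂
      simpa [hval] using eq (L := L) (A := A) x y
    | rel R ts =>
      choose s hs using fun i => hterm (ts i)
      obtain rfl : ts = fun i => Term.var (s i) := funext hs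
      have := rel (A := A) R s
      simp only [BoundedFormula.realize_rel, hval, Term.realize_var]
      exact this
  | conj _ _ h₁ h₂ =>
    simp only [BoundedFormula.realize_inf]
    exact h₁.inter h₂
  | @exist n φ _ h =>
    have := h.image (Sum.map id Fin.castSucc : α ⊕ Fin n → α ⊕ Fin (n + 1))
    convert this using 1
    ext x
    simp only [Set.mem_ofPred_eq, BoundedFormula.realize_ex]
    constructor
    · rintro ⟨a, ha⟩
      refine ⟨Sum.elim (x ∘ Sum.inl) (Fin.snoc (x ∘ Sum.inr) a), by simpa using ha, ?_⟩
      ext y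
      cases y <;> simp
    · rintro ⟨f, hf, rfl⟩
      refine ⟨f (Sum.inr (Fin.last n)), ?_⟩
      have e : (Fin.snoc ((f ∘ Sum.map id Fin.castSucc) ∘ Sum.inr) (f (Sum.inr (Fin.last n))) :
          Fin (n + 1) → A) = f ∘ Sum.inr := by
        ext i
        refine Fin.lastCases ?_ (fun i => ?_) i <;> simp
      rw [e]
      exact hf

theorem of_isPPDefinable [L.IsRelational] {n : ℕ} {S : Set (Fin n → A)} (hS : IsPPDefinable L S) :
    IsPP L S := by
  obtain ⟨φ, hφ, rfl⟩ := hS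
  have := (of_boundedFormula (A := A) hφ).image (Sum.inl : Fin n → Fin n ⊕ Fin 0)
  convert this using 1
  ext x
  constructor
  · intro hx
    refine ⟨Sum.elim x default, ?_, rfl⟩
    simpa [FirstOrder.Language.Formula.Realize, Subsingleton.elim _ (default : Fin 0 → A)] using hx
  · rintro ⟨f, hf, rfl⟩
    simpa [FirstOrder.Language.Formula.Realize, Subsingleton.elim _ (default : Fin 0 → A)] using hf

open FirstOrder.Language in
theorem isPPDefinable {n : ℕ} {S : Set (Fin n → A)} (hS : IsPP L S) (hn : n ≠ 0) :
    IsPPDefinable L S := by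
  obtain ⟨H, _, l, rfl⟩ := hS
  obtain ⟨m, ⟨e⟩⟩ := Finite.exists_equiv_fin H
  have hl : ∃ φ : L.BoundedFormula (Fin n) m, IsPrimitivePositive φ ∧
      ∀ (x : Fin n → A) (y : Fin m → A), φ.Realize x y ↔
        ∀ a ∈ l, a.Holds (Sum.elim x (y ∘ e)) := by
    induction l with
    | nil =>
      -- The empty conjunction is expressed by a trivial equality, which needs a free variable; this
      -- is where `n ≠ 0` enters.
      let x₀ : L.Term (Fin n ⊕ Fin m) := Term.var (Sum.inl ⟨0, Nat.pos_of_ne_zero hn⟩)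
      exact ⟨x₀.bdEqual x₀, .atomic (.equal _ _), by simp⟩
    | cons a l ih =>
      obtain ⟨φ, hφ, h⟩ := ih
      have ev : ∀ (x : Fin n → A) (y : Fin m → A),
          Sum.elim x y ∘ Sum.map id e = Sum.elim x (y ∘ e) := by
        intro x y; ext z; cases z <;> rfl
      cases a with
      | rel R t =>
        refine ⟨R.boundedFormula (fun i => Term.var (Sum.map id e (t i))) ⊓ φ,
          .conj (.atomic (.rel _ _)) hφ, fun x y => ?_⟩
        rw [BoundedFormula.realize_inf, h, List.forall_mem_cons, BoundedFormula.realize_rel,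
          PPAtom.Holds, ← ev]
        rfl
      | eq p q =>
        refine ⟨(Term.var (Sum.map id e p)).bdEqual (Term.var (Sum.map id e q)) ⊓ φ,
          .conj (.atomic (.equal _ _)) hφ, fun x y => ?_⟩
        rw [BoundedFormula.realize_inf, h, List.forall_mem_cons, BoundedFormula.realize_bdEqual,
          PPAtom.Holds, ← ev]
        rfl
  obtain ⟨φ, hφ, h⟩ := hl
  have hexs : ∀ {m : ℕ} (φ : L.BoundedFormula (Fin n) m), IsPrimitivePositive φ →
      IsPrimitivePositive φ.exs := by
    intro m
    induction m with
    | zero => exact fun φ hφ => hφ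
    | succ m ih => exact fun φ hφ => ih _ (.exist hφ)
  refine ⟨φ.exs, hexs φ hφ, ?_⟩
  ext x
  simp only [Set.mem_ofPred_eq, BoundedFormula.realize_exs, h]
  constructor
  · rintro ⟨y, hy⟩
    exact ⟨y ∘ e.symm, by simpa [Function.comp_assoc] using hy⟩
  · rintro ⟨y, hy⟩
    exact ⟨y ∘ e, hy⟩

end IsPP

/-! ### Decomposability from strict width -/

/-- Every primitive positive relation over `A` is determined by its projections to at most `N`
coordinates. -/
def IsDecomposable (L : FirstOrder.Language.{u, v}) (A : Type w) [L.Structure A] (N : ℕ) : Prop :=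
  ∀ (F : Type) [Finite F] (T : Set (F → A)), IsPP L T → ∀ g : F → A,
    (∀ W : Finset F, W.card ≤ N → ∃ f ∈ T, ∀ x ∈ W, f x = g x) → g ∈ T

section StrictWidth

variable {L : FirstOrder.Language.{u, v}} {A : Type w} [L.Structure A]

theorem ncard_range_le_fin {V : Type*} {n : ℕ} (t : Fin n → V) : (Set.range t).ncard ≤ n := by
  rw [← Set.image_univ]
  refine (Set.ncard_image_le (Set.toFinite _)).trans ?_
  rw [Set.ncard_univ, Nat.card_eq_fintype_card, Fintype.card_fin]

/-- The constraint given by a relation and a tuple of variables. -/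
def PPAtom.constraint {V : Type} {n : ℕ} (hn : n ≠ 0) (R : L.Relations n) (t : Fin n → V) :
    CSPConstraint V A where
  scope := Set.range t
  scope_nonempty := ⟨t ⟨0, Nat.pos_of_ne_zero hn⟩, Set.mem_range_self _⟩
  rel := {f | f ∘ Set.rangeFactorization t ∈ relOf A R}

/-- The constraint with scope `Z` that is the projection of the set of assignments `S`. -/
def projConstraint {V : Type} (S : Set (V → A)) (Z : Set V) (hZ : Z.Nonempty) :
    CSPConstraint V A where
  scope := Z
  scope_nonempty := hZ
  rel := {f | ∃ h ∈ S, f = fun x : Z => h x}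

/-- Instances have no equality constraints, so the equality atoms are absorbed by passing to the
quotient of the variables that they generate. The map `r` sends each coordinate to its class. -/
theorem IsPP.exists_instance {F : Type} [Finite F] {T : Set (F → A)} (hT : IsPP L T)
    (hne : T.Nonempty) :
    ∃ (W : Type) (_ : Finite W) (r : F → W) (J : CSPInstance W A),
      J.IsOver (structureRels L A) ∧ IsPP L {f | J.IsSolution f} ∧
        (∀ C ∈ J.constraints, ∃ n, C.scope.ncard ≤ n ∧ Nonempty (L.Relations n)) ∧
        T = {g | ∃ f, J.IsSolution f ∧ g = f ∘ r} := by
  obtain ⟨H, _, l, rfl⟩ := hT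
  let s : Setoid (F ⊕ H) := Relation.EqvGen.setoid fun x y => PPAtom.eq x y ∈ l
  let q : F ⊕ H → Quotient s := Quotient.mk s
  -- Constraints have non-empty scopes, so nullary atoms must be dropped. They hold automatically
  -- because `T` has a member.
  have hl₀ : ∀ R : L.Relations 0, ∀ t, PPAtom.rel R t ∈ l → ∀ f : Fin 0 → A, f ∈ relOf A R := by
    obtain ⟨g, h, hh⟩ := hne
    intro R t ha f
    rw [Subsingleton.elim f (Sum.elim g h ∘ t)]
    exact hh _ ha
  let J : CSPInstance (Quotient s) A :=
    ⟨{C | ∃ a ∈ l, ∃ (n : ℕ) (hn : n ≠ 0) (R : L.Relations n) (t : Fin n → F ⊕ H),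
      a = PPAtom.rel R t ∧ C = PPAtom.constraint hn R (q ∘ t)}, by
      refine ((l.finite_toSet).biUnion (t := fun a => {C | ∃ (n : ℕ) (hn : n ≠ 0)
        (R : L.Relations n) (t : Fin n → F ⊕ H), a = PPAtom.rel R t ∧
          C = PPAtom.constraint hn R (q ∘ t)}) fun a _ => ?_).subset ?_
      · refine Set.Subsingleton.finite ?_
        rintro _ ⟨n, hn, R, t, rfl, rfl⟩ _ ⟨n', hn', R', t', h, rfl⟩
        cases h
        rfl
      · rintro C ⟨a, ha, h⟩
        exact Set.mem_biUnion ha h⟩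
  have hJ : ∀ f : Quotient s → A, J.IsSolution f ↔ ∀ a ∈ l, a.Holds (f ∘ q) := by
    intro f
    constructor
    · intro hf a ha
      cases a with
      | @rel n R t =>
        by_cases hn : n = 0
        · subst hn
          exact hl₀ R t ha _
        · exact hf _ ⟨_, ha, n, hn, R, t, rfl, rfl⟩
      | eq x y => exact congrArg f (Quotient.sound (Relation.EqvGen.rel _ _ ha))
    · rintro hf C ⟨a, ha, n, hn, R, t, rfl, rfl⟩
      exact hf _ ha
  refine ⟨Quotient s, inferInstance, q ∘ Sum.inl, J, ?_, ?_, ?_, ?_⟩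
  · rintro C ⟨a, ha, n, hn, R, t, rfl, rfl⟩
    exact ⟨n, Set.rangeFactorization (q ∘ t), Set.rangeFactorization_surjective, relOf A R,
      ⟨R, rfl⟩, fun f => Iff.rfl⟩
  · convert IsPP.of_atoms (A := A) (l.map (PPAtom.map q)) using 1
    ext f
    simp [hJ, PPAtom.holds_map]
  · rintro C ⟨a, ha, n, hn, R, t, rfl, rfl⟩
    refine ⟨n, ?_, ⟨R⟩⟩
    exact ncard_range_le_fin (q ∘ t)
  · ext g
    constructor
    · rintro ⟨h, hh⟩
      have hresp : ∀ x y, s x y → Sum.elim g h x = Sum.elim g h y := by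
        intro x y hxy
        induction hxy with
        | rel x y ha => exact hh _ ha
        | refl => rfl
        | symm _ _ _ ih => exact ih.symm
        | trans _ _ _ _ _ ih₁ ih₂ => exact ih₁.trans ih₂
      exact ⟨Quotient.lift _ hresp, (hJ _).2 hh, rfl⟩
    · rintro ⟨f, hf, rfl⟩
      refine ⟨f ∘ q ∘ Sum.inr, ?_⟩
      have e : Sum.elim (f ∘ q ∘ Sum.inl) (f ∘ q ∘ Sum.inr) = f ∘ q := by
        ext x; cases x <;> rfl
      intro a ha
      have := (hJ f).1 hf a ha
      rw [← e] at this
      exact this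

/-- The instance whose constraints are all projections of `S` to non-empty sets of at most `l`
variables or at most as many variables as some relation of the structure has. -/
def projInstance (L : FirstOrder.Language.{u, v}) {A : Type w} {V : Type} [Finite V]
    (S : Set (V → A)) (l : ℕ) : CSPInstance V A where
  constraints := {C | ∃ (Z : Set V) (hZ : Z.Nonempty),
    (Z.ncard ≤ l ∨ ∃ m, Z.ncard ≤ m ∧ Nonempty (L.Relations m)) ∧ C = projConstraint S Z hZ}
  finite := by
    refine ((Set.toFinite (Set.univ : Set (Set V))).biUnion
      (t := fun Z => {C | ∃ hZ, C = projConstraint S Z hZ}) fun Z _ => ?_).subset ?_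
    · refine Set.Subsingleton.finite ?_
      rintro _ ⟨_, rfl⟩ _ ⟨_, rfl⟩
      rfl
    · rintro C ⟨Z, hZ, _, h⟩
      exact Set.mem_biUnion (Set.mem_univ Z) ⟨hZ, h⟩

/-- Every scope of `J` is no larger than some arity of the structure, so it is among the scopes of
the projection instance, and nothing is lost. -/
theorem projInstance_isSolution_iff {D : Type w} {V : Type} [Finite V] {J : CSPInstance V D}
    (har : ∀ C ∈ J.constraints, ∃ n, C.scope.ncard ≤ n ∧ Nonempty (L.Relations n)) (l : ℕ)
    (f : V → D) : (projInstance L {f | J.IsSolution f} l).IsSolution f ↔ J.IsSolution f := by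
  refine ⟨fun hf C hC => ?_, fun hf => ?_⟩
  · obtain ⟨n, hn, hR⟩ := har C hC
    obtain ⟨h, hh, e⟩ := hf _ ⟨C.scope, C.scope_nonempty, .inr ⟨n, hn, hR⟩, rfl⟩
    have e' : (fun x : C.scope => f x) = fun x : C.scope => h x := e
    rw [e']
    exact hh C hC
  · rintro C ⟨Z, hZ, _, rfl⟩
    exact ⟨f, hf, rfl⟩

/-- Minimality is automatic: all constraints are projections of one common set, so they agree on
every shared tuple of variables. -/
theorem isMinimalInstanceOf_projInstance {V : Type} [Finite V] {J : CSPInstance V A}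
    (hJ : J.IsOver (structureRels L A)) (hpp : IsPP L {f | J.IsSolution f})
    (har : ∀ C ∈ J.constraints, ∃ n, C.scope.ncard ≤ n ∧ Nonempty (L.Relations n)) (k l : ℕ) :
    IsMinimalInstanceOf L k l (projInstance L {f | J.IsSolution f} l) := by
  refine ⟨?_, ⟨?_, ?_⟩, J, hJ, projInstance_isSolution_iff har l⟩
  · rintro C ⟨Z, hZ, hcard, rfl⟩
    let e : Fin Z.ncard ≃ Z := (Finite.equivFinOfCardEq (Nat.card_coe_set_eq Z)).symm
    refine ⟨Z.ncard, e, e.surjective, {g | ∃ h ∈ {f | J.IsSolution f}, g = h ∘ (fun i => (e i : V))},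
      ⟨hcard, (hpp.image _).isPPDefinable ?_⟩, fun f => ?_⟩
    · exact (Set.ncard_pos (Set.toFinite Z)).2 hZ |>.ne'
    · constructor
      · rintro ⟨h, hh, rfl⟩
        exact ⟨h, hh, rfl⟩
      · rintro ⟨h, hh, e'⟩
        refine ⟨h, hh, ?_⟩
        ext x
        obtain ⟨i, rfl⟩ := e.surjective x
        exact congrFun e' i
  · intro m hm hml t
    refine ⟨projConstraint _ (Set.range t) ⟨t ⟨0, hm⟩, Set.mem_range_self _⟩,
      ⟨Set.range t, _, .inl ?_, rfl⟩, fun i => Set.mem_range_self i⟩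
    exact (ncard_range_le_fin t).trans hml
  · rintro m _ _ t _ ⟨Z₁, hZ₁, _, rfl⟩ _ ⟨Z₂, hZ₂, _, rfl⟩ h₁ h₂
    ext g
    constructor <;>
    · rintro ⟨_, ⟨h, hh, rfl⟩, rfl⟩
      exact ⟨_, ⟨h, hh, rfl⟩, rfl⟩

/-- The relation is the projection of a solution set. A tuple that is correct on few coordinates is
a consistent partial assignment for the minimal instance of all small projections, and strict width
extends it to a solution. -/
theorem HasStrictWidth.exists_isDecomposable {m : ℕ} (h : HasStrictWidth L A m)
    (har : HasBoundedArity L) : ∃ N, IsDecomposable L A N := by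
  classical
  obtain ⟨l, -, hl⟩ := h
  obtain ⟨a, ha⟩ := har
  -- Two coordinates suffice to see that `g` respects the fibres of `r`; `l` and the arity bound `a`
  -- control the sizes of the scopes.
  refine ⟨max 2 (max l a), fun F _ T hT g hg => ?_⟩
  have hne : T.Nonempty := by
    obtain ⟨f, hf, -⟩ := hg ∅ (by simp)
    exact ⟨f, hf⟩
  obtain ⟨W, _, r, J, hJ, hpp, harJ, rfl⟩ := hT.exists_instance hne
  have hker : ∀ x y, r x = r y → g x = g y := by
    intro x y hxy
    obtain ⟨_, ⟨f, -, rfl⟩, hf⟩ := hg {x, y} (Finset.card_le_two.trans (le_max_left _ _))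
    rw [← hf x (by simp), ← hf y (by simp)]
    exact congrArg f hxy
  choose p hp using fun x : Set.range r => x.2
  obtain ⟨f, hf, hfg⟩ := hl W (projInstance L {f | J.IsSolution f} l)
    (isMinimalInstanceOf_projInstance hJ hpp harJ m l) (Set.range r) (fun x => g (p x)) (by
      rintro C ⟨Z, hZ, hcard, rfl⟩
      have hZl : Z.ncard ≤ max 2 (max l a) := by
        rcases hcard with h | ⟨n, hn, hR⟩
        · omega
        · have : n ≤ a := by
            by_contra hlt
            exact (ha n (not_le.1 hlt)).elim hR.some
          omega
      -- One coordinate is chosen above each visible variable of the scope `Z`, so `Q` is no larger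
      -- than `Z`.
      let Q : Finset F := Finset.univ.image (α := (Set.range r ∩ Z).toFinite.toFinset)
        fun x => p ⟨x.1, ((Set.Finite.mem_toFinset _).1 x.2).1⟩
      obtain ⟨_, ⟨f, hf, rfl⟩, hfQ⟩ := hg Q (by
        refine Finset.card_image_le.trans ?_
        rw [Finset.card_univ, Fintype.card_coe, ← Set.ncard_eq_toFinset_card]
        exact (Set.ncard_le_ncard Set.inter_subset_right (Set.toFinite _)).trans hZl)
      refine ⟨_, ⟨f, hf, rfl⟩, fun x hU hC => ?_⟩
      have hx := hfQ (p ⟨x, hU⟩) (Finset.mem_image.2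
        ⟨⟨x, (Set.Finite.mem_toFinset _).2 ⟨hU, hC⟩⟩, Finset.mem_univ _, rfl⟩)
      exact (congrArg f (hp ⟨x, hU⟩).symm).trans hx)
  refine ⟨f, ?_, ?_⟩
  · exact (projInstance_isSolution_iff harJ l f).1 hf
  · ext x
    have := hfg ⟨r x, Set.mem_range_self x⟩
    rw [Function.comp_apply, this]
    exact hker _ _ (hp ⟨r x, Set.mem_range_self x⟩).symm

end StrictWidth

/-! ### A relation that is not decomposable -/

section Gadget

variable {L : FirstOrder.Language.{u, v}} {A : Type w} [L.Structure A]

/-- Chains of copies of a relation `Ψ` with an input `i` and an output `o`, such that the copies are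
independent once their values on `Y` are not prescribed, contradict decomposability. -/
theorem IsDecomposable.false_of_propagates {N : ℕ} (hN : IsDecomposable L A N) {Z : Type} [Finite Z]
    {Ψ : Set (Z → A)} (hΨ : IsPP L Ψ) (i o : Z) (Y : Set Z) (g₀ : Z → A) (C : Set A) {e e' : A}
    (he : e ∈ C) (he' : e' ∉ C)
    (hC : ∀ H ∈ Ψ, (∀ y ∈ Y, H y = g₀ y) → H i ∈ C → H o ∈ C)
    (h₁ : ∃ H ∈ Ψ, (∀ y ∈ Y, H y = g₀ y) ∧ H i = e ∧ H o = e)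
    (h₂ : ∃ H ∈ Ψ, (∀ y ∈ Y, H y = g₀ y) ∧ H i = e' ∧ H o = e')
    (h₃ : ∃ H ∈ Ψ, H i = e ∧ H o = e') : False := by
  classical
  obtain ⟨H₁, hH₁, hY₁, hi₁, ho₁⟩ := h₁
  obtain ⟨H₂, hH₂, hY₂, hi₂, ho₂⟩ := h₂
  obtain ⟨H₃, hH₃, hi₃, ho₃⟩ := h₃
  -- The output of each of the `N + 1` copies is glued to the input of the next. Only the
  -- coordinates in `Y` and the two ends of the chain are kept by `r`.
  let S : Set (Fin (N + 1) × Z → A) :=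
    {H | ∀ b : Fin (N + 1), H ∈ {H : Fin (N + 1) × Z → A | H ∘ (Prod.mk b) ∈ Ψ}} ∩
      {H | ∀ b : Fin N, H ∈ {H : Fin (N + 1) × Z → A | H (b.castSucc, o) = H (b.succ, i)}}
  have hS : IsPP L S :=
    (IsPP.iInter fun b => hΨ.reindex _).inter (IsPP.iInter fun b => IsPP.eq _ _)
  let r : (Fin (N + 1) × Y) ⊕ Bool → Fin (N + 1) × Z :=
    Sum.elim (fun p => (p.1, p.2)) fun s => if s then (Fin.last N, o) else (0, i)
  let g : (Fin (N + 1) × Y) ⊕ Bool → A :=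
    Sum.elim (fun p => g₀ p.2) fun s => if s then e' else e
  have hg := hN _ _ (hS.image r) g fun W hW => by
    -- By pigeonhole some copy has no coordinate of `Y` in `W`. There `H₃` switches from `e` to
    -- `e'`; earlier copies use `H₁` and later ones `H₂`.
    obtain ⟨b₀, hb₀⟩ : ∃ b₀ : Fin (N + 1), ∀ y, Sum.inl (b₀, y) ∉ W := by
      by_contra! hcon
      choose y hy using hcon
      have := Finset.card_le_card_of_injOn (s := Finset.univ) (t := W)
        (fun b => (Sum.inl (b, y b) : (Fin (N + 1) × Y) ⊕ Bool)) (fun b _ => hy b)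
        (fun b _ b' _ h => by simpa using congrArg (Sum.elim Prod.fst fun _ => b) h)
      simp at this
      omega
    let H : Fin (N + 1) × Z → A := fun p =>
      if p.1 < b₀ then H₁ p.2 else if p.1 = b₀ then H₃ p.2 else H₂ p.2
    refine ⟨_, ⟨H, ⟨fun b => ?_, fun b => ?_⟩, rfl⟩, ?_⟩
    · rcases lt_trichotomy b b₀ with h | h | h
      · have : H ∘ Prod.mk b = H₁ := by ext z; simp [H, h]
        simpa [this] using hH₁
      · have : H ∘ Prod.mk b = H₃ := by ext z; simp [H, h]
        simpa [this] using hH₃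
      · have : H ∘ Prod.mk b = H₂ := by ext z; simp [H, h.not_gt, h.ne']
        simpa [this] using hH₂
    · change H _ = H _
      rcases lt_trichotomy b.castSucc b₀ with h | h | h
      · have h' : b.succ ≤ b₀ := Fin.castSucc_lt_iff_succ_le.1 h
        rcases h'.lt_or_eq with h' | h'
        · simp [H, h, h', hi₁, ho₁]
        · simp [H, h, h', hi₃, ho₁]
      · have h' : b₀ < b.succ := h ▸ Fin.castSucc_lt_succ
        simp [H, h, h'.not_gt, h'.ne', hi₂, ho₃]
      · have h' : b₀ < b.succ := h.trans Fin.castSucc_lt_succ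
        simp [H, h.not_gt, h.ne', h'.not_gt, h'.ne', hi₂, ho₂]
    · rintro (⟨b, y⟩ | s) hx
      · have hb : b ≠ b₀ := by
          rintro rfl
          exact hb₀ y hx
        rcases hb.lt_or_gt with h | h
        · simp [H, r, g, h, hY₁]
        · simp [H, r, g, h.not_gt, h.ne', hY₂]
      · cases s
        · rcases (Fin.zero_le b₀).lt_or_eq with h | h
          · simp [H, r, g, h, hi₁]
          · simp [H, r, g, ← h, hi₃]
        · rcases (Fin.le_last b₀).lt_or_eq with h | h
          · simp [H, r, g, h.not_gt, h.ne', ho₂]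
          · simp [H, r, g, h, ho₃]
  obtain ⟨H, ⟨hHΨ, hHl⟩, hgH⟩ := hg
  have hY : ∀ b, ∀ y ∈ Y, H (b, y) = g₀ y := fun b y hy =>
    (congrFun hgH (Sum.inl (b, ⟨y, hy⟩))).symm
  -- In a genuine member of the chain all of `Y` is prescribed, so membership in `C` travels to the
  -- end.
  have key : ∀ b : Fin (N + 1), H (b, i) ∈ C := by
    intro b
    induction b using Fin.induction with
    | zero =>
      have : e = H (0, i) := congrFun hgH (Sum.inr false)
      rwa [← this]
    | succ b ih =>
      have := hHl b
      rw [← show H (b.castSucc, o) = H (b.succ, i) from this]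
      exact hC _ (hHΨ _) (hY _) ih
  have h : e' = H (Fin.last N, o) := congrFun hgH (Sum.inr true)
  exact he' (h ▸ hC _ (hHΨ _) (hY _) (key _))

end Gadget

/-! ### Neoliberal groups -/

namespace IsNeoliberalGroup

variable {B : Type w} {k : ℕ} {G : Subgroup (Equiv.Perm B)}

/-- The set is listed as a `(k - 1)`-tuple by padding with an element `s₀ ≠ b`, taken from `S` if
possible. For empty `S` the padding still needs an element other than `b`, hence the nontriviality.
-/
theorem exists_move [Nontrivial B] (hG : IsNeoliberalGroup k G) (S : Finset B)
    (hS : S.card ≤ k - 1) {b : B} (hb : b ∉ S) :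
    ∃ g ∈ G, (∀ s ∈ S, g s = s) ∧ g b ≠ b := by
  classical
  obtain ⟨s₀, hs₀, hS₀⟩ : ∃ s₀ : B, s₀ ≠ b ∧ (S.Nonempty → s₀ ∈ S) := by
    rcases S.eq_empty_or_nonempty with rfl | ⟨s, hs⟩
    · obtain ⟨s, hs⟩ := exists_ne b
      exact ⟨s, hs, by simp⟩
    · exact ⟨s, fun h => hb (h ▸ hs), fun _ => hs⟩
  by_contra! hcon
  let a : Fin (k - 1) → B := fun i => if h : i.1 < S.card then S.equivFin.symm ⟨i, h⟩ else s₀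
  obtain ⟨i, hi⟩ := hG.noAlgebraicity a b fun g hg hga => hcon g hg fun s hs => by
    have hlt := (S.equivFin ⟨s, hs⟩).2
    have := hga ⟨S.equivFin ⟨s, hs⟩, by omega⟩
    simpa [a] using this
  by_cases h : i.1 < S.card
  · simp only [a, h, dif_pos] at hi
    exact hb (hi ▸ (S.equivFin.symm ⟨i, h⟩).2)
  · simp only [a, h, dif_neg, not_false_eq_true] at hi
    exact hs₀ hi

/-- With fewer than `k` points, a permutation that fixes all points but one would fix the last one
as well, contradicting `exists_move`. -/
theorem exists_injective [Nontrivial B] (hG : IsNeoliberalGroup k G) :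
    ∃ a : Fin k → B, Function.Injective a := by
  classical
  rcases finite_or_infinite B with h | h
  · have := Fintype.ofFinite B
    by_cases hcard : k ≤ Fintype.card B
    · obtain ⟨f⟩ := Function.Embedding.nonempty_of_card_le (α := Fin k) (β := B) (by simpa)
      exact ⟨f, f.injective⟩
    · obtain ⟨b, -⟩ := exists_pair_ne B
      obtain ⟨g, -, hgS, hgb⟩ := hG.exists_move (Finset.univ.erase b)
        (by rw [Finset.card_erase_of_mem (Finset.mem_univ b), Finset.card_univ]; omega)
        (Finset.notMem_erase b _)
      exact absurd (g.injective (hgS (g b) (Finset.mem_erase.2 ⟨hgb, Finset.mem_univ _⟩))) hgb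
  · exact ⟨fun i => Infinite.natEmbedding B i,
      fun i j h => Fin.ext ((Infinite.natEmbedding B).injective h)⟩

/-- Transitivity on injective `(k - 1)`-tuples passes down to shorter tuples because there are
enough points to extend them. -/
theorem exists_map_eq [Nontrivial B] (hG : IsNeoliberalGroup k G) {V : Type*}
    (U : Finset V) (hU : U.card ≤ k - 1) {f f' : V → B} (hf : Set.InjOn f U)
    (hf' : Set.InjOn f' U) : ∃ g ∈ G, ∀ x ∈ U, g (f x) = f' x := by
  have hcard : ((k - 1 : ℕ) : ENat) ≤ ENat.card B := by
    obtain ⟨a, ha⟩ := hG.exists_injective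
    have := ENat.card_le_card_of_injective ha
    refine le_trans ?_ this
    simp
  have := hG.transitive
  have htr : MulAction.IsMultiplyPretransitive G B U.card :=
    MulAction.isMultiplyPretransitive_of_le' hU hcard
  let a : Fin U.card ↪ B := ⟨fun i => f (U.equivFin.symm i), fun i j h =>
    U.equivFin.symm.injective (Subtype.ext (hf (U.equivFin.symm i).2 (U.equivFin.symm j).2 h))⟩
  let a' : Fin U.card ↪ B := ⟨fun i => f' (U.equivFin.symm i), fun i j h =>
    U.equivFin.symm.injective (Subtype.ext (hf' (U.equivFin.symm i).2 (U.equivFin.symm j).2 h))⟩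
  obtain ⟨g, hg⟩ := MulAction.exists_smul_eq G a a'
  refine ⟨g, g.2, fun x hx => ?_⟩
  have : g • f (U.equivFin.symm (U.equivFin ⟨x, hx⟩)) = f' (U.equivFin.symm (U.equivFin ⟨x, hx⟩)) :=
    DFunLike.congr_fun hg (U.equivFin ⟨x, hx⟩)
  rw [Equiv.symm_apply_apply] at this
  exact this

theorem exists_map_eq_of_forall (hG : IsNeoliberalGroup k G) {V : Type*}
    (U : Finset V) (hU : k ≤ U.card) {f f' : V → B}
    (h : ∀ y : Fin k → V, Function.Injective y → (∀ i, y i ∈ U) →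
      ∃ g ∈ G, ∀ i, g (f (y i)) = f' (y i)) : ∃ g ∈ G, ∀ x ∈ U, g (f x) = f' x := by
  obtain ⟨g, hg⟩ := hG.homogeneous U.card hU (fun i => f' (U.equivFin.symm i))
    (fun i => f (U.equivFin.symm i)) fun i => by
      obtain ⟨g, hg, hgi⟩ := h (fun j => U.equivFin.symm (i j))
        (fun j j' hj => i.injective (U.equivFin.symm.injective (Subtype.ext hj)))
        (fun j => (U.equivFin.symm (i j)).2)
      exact ⟨⟨g, hg⟩, funext hgi⟩
  refine ⟨g, g.2, fun x hx => ?_⟩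
  have : g • f (U.equivFin.symm (U.equivFin ⟨x, hx⟩)) = f' (U.equivFin.symm (U.equivFin ⟨x, hx⟩)) :=
    congrFun hg (U.equivFin ⟨x, hx⟩)
  rw [Equiv.symm_apply_apply] at this
  exact this

end IsNeoliberalGroup

/-- The relations of the structure are invariant under the group. -/
def PreservesRels (L : FirstOrder.Language.{u, v}) {A : Type w} [L.Structure A]
    (G : Subgroup (Equiv.Perm A)) : Prop :=
  ∀ (n : ℕ) (R : L.Relations n), ∀ g ∈ G, ∀ f ∈ relOf A R, (g ∘ f : Fin n → A) ∈ relOf A R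

/-- A structure that is invariant under a `k`-neoliberal group, defines the orbits of injective
`k`-tuples, and has decomposable primitive positive relations. -/
structure IsDecomposableTemplate (L : FirstOrder.Language.{u, v}) {A : Type w} [L.Structure A]
    (k N : ℕ) (G : Subgroup (Equiv.Perm A)) : Prop where
  neoliberal : IsNeoliberalGroup k G
  three_le : 3 ≤ k
  preserves : PreservesRels L G
  orbit : ∀ a : Fin k → A, Function.Injective a → IsPP L {f : Fin k → A | ∃ g ∈ G, f = g ∘ a}
  decomposable : IsDecomposable L A N

namespace IsDecomposableTemplate

variable {L : FirstOrder.Language.{u, v}} {A : Type w} [L.Structure A] {k N : ℕ}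
  {G : Subgroup (Equiv.Perm A)} {F : Type}

/-- Since `2 ≤ k - 1`, all pairs of distinct points form one orbit, so disequality is the projection
of any orbit of injective `k`-tuples to two coordinates. -/
theorem ne [Finite F] [Nontrivial A] (hT : IsDecomposableTemplate L k N G) (x y : F) :
    IsPP L {f : F → A | f x ≠ f y} := by
  classical
  obtain ⟨a, ha⟩ := hT.neoliberal.exists_injective
  have hk := hT.three_le
  let i₀ : Fin k := ⟨0, by omega⟩
  let i₁ : Fin k := ⟨1, by omega⟩
  have hi : i₀ ≠ i₁ := by simp [i₀, i₁]
  have := ((((hT.orbit a ha).reindex (Sum.inr : Fin k → F ⊕ Fin k)).inter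
    (IsPP.eq (Sum.inl x) (Sum.inr i₀))).inter (IsPP.eq (Sum.inl y) (Sum.inr i₁))).image
      (Sum.inl : F → F ⊕ Fin k)
  convert this using 1
  ext f
  constructor
  · intro hf
    have hf' : f x ≠ f y := hf
    obtain ⟨g, hg, hgf⟩ := hT.neoliberal.exists_map_eq {i₀, i₁}
      (Finset.card_le_two.trans (by omega)) (f := a) (f' := fun i => if i = i₀ then f x else f y)
      ha.injOn (by
        intro i hi' j hj' hij
        simp only [Finset.coe_insert, Finset.coe_singleton, Set.mem_insert_iff,
          Set.mem_singleton_iff] at hi' hj'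
        rcases hi' with rfl | rfl <;> rcases hj' with rfl | rfl
        · rfl
        · simp [hi.symm, hf'] at hij
        · simp [hi.symm, hf'.symm] at hij
        · rfl)
    refine ⟨Sum.elim f (g ∘ a), ⟨⟨⟨g, hg, rfl⟩, ?_⟩, ?_⟩, rfl⟩
    · have := hgf i₀ (by simp)
      simpa using this.symm
    · have := hgf i₁ (by simp)
      simpa [hi.symm] using this.symm
  · rintro ⟨f, ⟨⟨⟨g, hg, h⟩, h₀⟩, h₁⟩, rfl⟩
    change f (Sum.inl x) ≠ f (Sum.inl y)
    have h₀' : f (Sum.inl x) = g (a i₀) := Eq.trans h₀ (congrFun h i₀)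
    have h₁' : f (Sum.inl y) = g (a i₁) := Eq.trans h₁ (congrFun h i₁)
    rw [h₀', h₁']
    exact fun h => hi (ha (g.injective h))

theorem smul_mem (hT : IsDecomposableTemplate L k N G) {T : Set (F → A)} (hP : IsPP L T)
    {g : Equiv.Perm A} (hg : g ∈ G) {f : F → A} (hf : f ∈ T) : g ∘ f ∈ T :=
  hP.smul_mem hT.preserves hg hf

/-- A condition `O` on at most `k` pairwise distinct values cannot force an equality that is not
always true. -/
theorem eq_of_implies [Finite F] (hT : IsDecomposableTemplate L k N G) {φ O : Set (F → A)} (hφ : IsPP L φ)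
    (hO : IsPP L O) (U : Finset F) (hU : U.card ≤ k) (hUne : U.Nonempty)
    (hinj : ∀ f ∈ O, Set.InjOn f U) (hdep : ∀ f ∈ O, ∀ f', (∀ x ∈ U, f x = f' x) → f' ∈ O)
    {x y : F} (hne : ∃ f ∈ φ, f ∈ O) (himp : ∀ f ∈ φ, f ∈ O → f x = f y) :
    ∀ f ∈ φ, f x = f y := by
  classical
  by_contra! hcon
  obtain ⟨f₁, hf₁, hxy⟩ := hcon
  obtain ⟨f₀, hf₀, hf₀O⟩ := hne
  have : Nontrivial A := ⟨_, _, hxy⟩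
  have hk := hT.three_le
  -- If `f₀ x` is attained on `U`, then `p` is the place where this happens; otherwise any `p` will
  -- do. The other at most `k - 1` values can then be fixed while `f₀ x` is moved.
  obtain ⟨p, hp, hpx⟩ : ∃ p ∈ U, f₀ x ∉ (U.erase p).image f₀ := by
    by_cases h : ∃ p ∈ U, f₀ p = f₀ x
    · obtain ⟨p, hp, hpx⟩ := h
      refine ⟨p, hp, fun hmem => ?_⟩
      obtain ⟨q, hq, hqx⟩ := Finset.mem_image.1 hmem
      exact (Finset.mem_erase.1 hq).1
        (hinj f₀ hf₀O (Finset.mem_erase.1 hq).2 hp (hqx.trans hpx.symm))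
    · push Not at h
      obtain ⟨p, hp⟩ := hUne
      refine ⟨p, hp, fun hmem => ?_⟩
      obtain ⟨q, hq, hqx⟩ := Finset.mem_image.1 hmem
      exact h q (Finset.mem_erase.1 hq).2 hqx
  obtain ⟨d, hd, hdU, hdx⟩ := hT.neoliberal.exists_move ((U.erase p).image f₀)
    (Finset.card_image_le.trans (by rw [Finset.card_erase_of_mem hp]; omega)) hpx
  have h2 : (Finset.univ : Finset Bool).card ≤ k - 1 := by
    rw [Finset.card_univ, Fintype.card_bool]
    omega
  have hbool : ∀ a b : A, a ≠ b → Function.Injective fun s : Bool => if s then b else a := by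
    rintro a b hab (_ | _) (_ | _) h
    exacts [rfl, absurd h hab, absurd h.symm hab, rfl]
  obtain ⟨d₁, hd₁, hd₁e⟩ := hT.neoliberal.exists_map_eq Finset.univ h2
    (f := fun s : Bool => if s then f₁ y else f₁ x)
    (f' := fun s : Bool => if s then d (f₀ x) else f₀ x)
    (hbool _ _ hxy).injOn (hbool _ _ (Ne.symm hdx)).injOn
  have hd₁x : d₁ (f₁ x) = f₀ x := by simpa using hd₁e false (Finset.mem_univ _)
  have hd₁y : d₁ (f₁ y) = d (f₀ x) := by simpa using hd₁e true (Finset.mem_univ _)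
  obtain ⟨d₂, hd₂, hd₂p⟩ := hT.neoliberal.exists_map_eq (V := Unit) Finset.univ
    (by rw [Finset.card_univ, Fintype.card_unit]; omega) (f := fun _ => f₀ p) (f' := fun _ => d₁ (f₁ p))
    (fun _ _ _ _ _ => rfl) (fun _ _ _ _ _ => rfl)
  have hd₂p : d₂ (f₀ p) = d₁ (f₁ p) := hd₂p () (Finset.mem_univ _)
  have hxy₀ := himp f₀ hf₀ hf₀O
  -- One block satisfies `O`, the other `φ`, and they are tied only at `p`. Prescribing `f₀` on the
  -- rest of `U` in both blocks transfers `O` to the `φ`-block and forces the equality. Without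
  -- this, the `φ`-block can be a translate of `f₁`.
  let Ψ : Set (Bool × F → A) := ({H | H ∘ Prod.mk false ∈ O} ∩ {H | H ∘ Prod.mk true ∈ φ}) ∩
    {H | H (false, p) = H (true, p)}
  refine hT.decomposable.false_of_propagates (Ψ := Ψ)
    (((hO.reindex _).inter (hφ.reindex _)).inter (IsPP.eq _ _)) (true, x) (true, y)
    {z | z.2 ∈ U ∧ z.2 ≠ p} (fun z => f₀ z.2) {f₀ x} (e := f₀ x) (e' := d (f₀ x)) rfl hdx ?_ ?_ ?_ ?_
  · rintro H ⟨⟨hHO, hHφ⟩, hHp⟩ hHY hHx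
    have hHO' : H ∘ Prod.mk true ∈ O := by
      refine hdep _ hHO _ fun q hq => ?_
      by_cases hqp : q = p
      · subst hqp
        exact hHp
      · exact (hHY (false, q) ⟨hq, hqp⟩).trans (hHY (true, q) ⟨hq, hqp⟩).symm
    exact (himp _ hHφ hHO').symm.trans hHx
  · exact ⟨fun z => f₀ z.2, ⟨⟨hf₀O, hf₀⟩, rfl⟩, fun _ _ => rfl, rfl, hxy₀.symm⟩
  · refine ⟨fun z => d (f₀ z.2), ⟨⟨hT.smul_mem hO hd hf₀O, hT.smul_mem hφ hd hf₀⟩, rfl⟩,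
      fun z hz => ?_, rfl, congrArg d hxy₀.symm⟩
    exact hdU _ (Finset.mem_image_of_mem _ (Finset.mem_erase.2 ⟨hz.2, hz.1⟩))
  · exact ⟨fun z => if z.1 then d₁ (f₁ z.2) else d₂ (f₀ z.2),
      ⟨⟨hT.smul_mem hO hd₂ hf₀O, hT.smul_mem hφ hd₁ hf₁⟩, hd₂p⟩, hd₁x, hd₁y⟩

/-- A non-empty primitive positive relation has a member without any avoidable equalities. -/
theorem exists_generic [Finite F] (hT : IsDecomposableTemplate L k N G) {φ : Set (F → A)} (hφ : IsPP L φ)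
    (hne : φ.Nonempty) : ∃ f ∈ φ, ∀ x y, (∃ g ∈ φ, g x ≠ g y) → f x ≠ f y := by
  classical
  have := Fintype.ofFinite F
  -- The second half makes the induction work: imposing the disequalities of `s` turns no avoidable
  -- equality into a forced one.
  have key : ∀ s : Finset (F × F), (∀ p ∈ s, ∃ g ∈ φ, g p.1 ≠ g p.2) →
      (∃ f ∈ φ, ∀ p ∈ s, f p.1 ≠ f p.2) ∧
      ∀ x y, (∃ g ∈ φ, g x ≠ g y) → ∃ f ∈ φ, (∀ p ∈ s, f p.1 ≠ f p.2) ∧ f x ≠ f y := by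
    intro s
    induction s using Finset.induction_on with
    | empty =>
      intro _
      obtain ⟨f, hf⟩ := hne
      exact ⟨⟨f, hf, by simp⟩, fun x y ⟨g, hg, h⟩ => ⟨g, hg, by simp, h⟩⟩
    | insert p s hps ih =>
      intro hs
      obtain ⟨-, ih⟩ := ih fun q hq => hs q (Finset.mem_insert_of_mem hq)
      obtain ⟨f, hf, hfs, hfp⟩ := ih _ _ (hs p (Finset.mem_insert_self p s))
      have : Nontrivial A := ⟨_, _, hfp⟩
      refine ⟨⟨f, hf, fun q hq => ?_⟩, fun x y hxy => ?_⟩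
      · rcases Finset.mem_insert.1 hq with rfl | hq
        exacts [hfp, hfs q hq]
      · by_contra! hcon
        obtain ⟨f', hf', hf's, hf'xy⟩ := ih x y hxy
        refine hf'xy (hT.eq_of_implies (φ := φ ∩ {f | ∀ q ∈ s, f ∈ {f : F → A | f q.1 ≠ f q.2}})
          (O := {f | f p.1 ≠ f p.2}) (hφ.inter (IsPP.finset_iInter s fun q _ => hT.ne q.1 q.2))
          (hT.ne p.1 p.2) {p.1, p.2} (Finset.card_le_two.trans (by linarith [hT.three_le]))
          (by simp) ?_ ?_ ⟨f, ⟨hf, hfs⟩, hfp⟩ ?_ f' ⟨hf', hf's⟩)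
        · intro f hf a ha b hb hab
          have hf' : f p.1 ≠ f p.2 := hf
          simp only [Finset.coe_insert, Finset.coe_singleton, Set.mem_insert_iff,
            Set.mem_singleton_iff] at ha hb
          rcases ha with rfl | rfl <;> rcases hb with rfl | rfl
          exacts [rfl, absurd hab hf', absurd hab.symm hf', rfl]
        · intro f hf f' hff'
          have hf' : f p.1 ≠ f p.2 := hf
          rw [hff' p.1 (by simp), hff' p.2 (by simp)] at hf'
          exact hf'
        · rintro f ⟨hf, hfs⟩ hfp
          refine hcon f hf fun q hq => ?_
          rcases Finset.mem_insert.1 hq with rfl | hq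
          exacts [hfp, hfs q hq]
  obtain ⟨⟨f, hf, hfs⟩, -⟩ := key (Finset.univ.filter fun p => ∃ g ∈ φ, g p.1 ≠ g p.2)
    (fun p hp => (Finset.mem_filter.1 hp).2)
  exact ⟨f, hf, fun x y hxy => hfs (x, y) (Finset.mem_filter.2 ⟨Finset.mem_univ _, hxy⟩)⟩

theorem orbit_on (hT : IsDecomposableTemplate L k N G) (U : Finset F) (hU : U.card = k) (f : F → A)
    (hf : Set.InjOn f U) : IsPP L {h : F → A | ∃ g ∈ G, ∀ x ∈ U, h x = g (f x)} := by
  let e : Fin k ≃ U := (U.equivFinOfCardEq hU).symm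
  have := (hT.orbit (fun i => f (e i)) fun i j h =>
    e.injective (Subtype.ext (hf (e i).2 (e j).2 h))).reindex (fun i => (e i : F))
  convert this using 1
  ext h
  constructor
  · rintro ⟨g, hg, hgx⟩
    exact ⟨g, hg, funext fun i => hgx _ (e i).2⟩
  · rintro ⟨g, hg, hgx⟩
    refine ⟨g, hg, fun x hx => ?_⟩
    have := congrFun hgx (e.symm ⟨x, hx⟩)
    simpa using this

/-- An assignment that is injective on `k` variables can be changed on the remaining variables such
that it has no avoidable equalities. -/
theorem exists_generic_extend [Finite F] (hT : IsDecomposableTemplate L k N G) {φ : Set (F → A)}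
    (hφ : IsPP L φ) (U : Finset F) (hU : U.card = k) {f : F → A} (hf : f ∈ φ)
    (hfU : Set.InjOn f U) :
    ∃ f' ∈ φ, (∀ x ∈ U, f' x = f x) ∧ ∀ x y, (∃ g ∈ φ, g x ≠ g y) → f' x ≠ f' y := by
  have hO := hT.orbit_on U hU f hfU
  -- A generic member of `φ` is taken inside the orbit of `f` on `U` and translated back by `g⁻¹`.
  -- Equalities forced by this orbit are already forced by `φ`, by `eq_of_implies`.
  obtain ⟨f', ⟨hf', g, hg, hgx⟩, hgen⟩ := hT.exists_generic (hφ.inter hO)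
    ⟨f, hf, 1, G.one_mem, fun _ _ => rfl⟩
  refine ⟨(g⁻¹ : Equiv.Perm A) ∘ f', hT.smul_mem hφ (G.inv_mem hg) hf', fun x hx => ?_,
    fun x y hxy h => ?_⟩
  · simp [hgx x hx]
  · have h' : f' x = f' y := (g⁻¹ : Equiv.Perm A).injective h
    by_contra
    obtain ⟨f₁, hf₁, hf₁xy⟩ := hxy
    refine hf₁xy (hT.eq_of_implies hφ hO U hU.le ?_ ?_ ?_ ⟨f, hf, 1, G.one_mem, fun _ _ => rfl⟩
      (fun h hh hhO => ?_) f₁ hf₁)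
    · exact Finset.card_pos.1 (by linarith [hT.three_le])
    · rintro h ⟨g, hg, hgx⟩ a ha b hb hab
      rw [hgx a ha, hgx b hb] at hab
      exact hfU ha hb (g.injective hab)
    · rintro h ⟨g, hg, hgx⟩ h' hh'
      exact ⟨g, hg, fun x hx => (hh' x hx).symm.trans (hgx x hx)⟩
    · by_contra hne
      exact hgen x y ⟨h, ⟨hh, hhO⟩, hne⟩ h'

end IsDecomposableTemplate

/-! ### Finite duality as a local-to-global principle -/

section Duality

variable {L : FirstOrder.Language.{u, v}} {B : Type w} [L.Structure B]

/-- If a system of relational constraints on the classes of `ν : Z → X` is satisfiable on any `d`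
classes, then it is satisfiable. -/
def IsLocallySatisfiable (L : FirstOrder.Language.{u, v}) (B : Type w) [L.Structure B] (d : ℕ) :
    Prop :=
  ∀ (Z X : Type w) [Finite Z] (ν : Z → X) (At : ∀ n, L.Relations n → Set (Fin n → Z)),
    (∀ D : Finset X, D.card ≤ d → ∃ h : Z → B, (∀ z z', ν z = ν z' → ν z ∈ D → h z = h z') ∧
      ∀ (n : ℕ) (R : L.Relations n), ∀ t ∈ At n R, (∀ i, ν (t i) ∈ D) → h ∘ t ∈ relOf B R) →
    ∃ H : X → B, ∀ (n : ℕ) (R : L.Relations n), ∀ t ∈ At n R, H ∘ ν ∘ t ∈ relOf B R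

/-- Take `d` as a bound on the sizes of the obstructions. An obstruction mapping to the finite
structure on the classes would hit at most `d` of them, and a local solution would then map the
obstruction itself to `B`. -/
theorem exists_isLocallySatisfiable [L.IsRelational] [Nonempty B]
    (hF : ∃ F : Set (FinStructure L), F.Finite ∧ IsObstructionSet F B) :
    ∃ d, IsLocallySatisfiable L B d := by
  classical
  obtain ⟨F, hfin, hF⟩ := hF
  obtain ⟨d, hd⟩ := (hfin.image fun Y => Y.1).bddAbove
  refine ⟨d, fun Z X _ ν At hloc => ?_⟩
  obtain ⟨n, ⟨e⟩⟩ := Finite.exists_equiv_fin (Set.range ν)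
  let M : FinStructure L := ⟨n,
    { funMap := fun f => isEmptyElim f
      RelMap := fun {m} R q => ∃ t ∈ At m R, ∀ i, q i = e (Set.rangeFactorization ν (t i)) }⟩
  obtain ⟨j⟩ := (hF M).2 fun Y hY => ⟨fun j => by
    let p : Fin Y.1 → Set.range ν := fun y => e.symm (j y)
    obtain ⟨h, hν, hh⟩ := hloc (Finset.univ.image fun y => (p y : X)) (Finset.card_image_le.trans (by
      rw [Finset.card_univ, Fintype.card_fin]
      exact hd ⟨Y, hY, rfl⟩))
    choose z hz using fun y => (p y).2
    let j' : Y.Carrier →[L] B :=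
      { toFun := fun y => h (z y)
        map_fun' := fun f => isEmptyElim f
        map_rel' := fun {m} R x hx => by
          obtain ⟨t, ht, htx⟩ := j.map_rel R x hx
          have hp : ∀ i, ν (t i) = p (x i) := fun i => by
            have : j (x i) = e (Set.rangeFactorization ν (t i)) := htx i
            simp only [p]
            erw [this, Equiv.symm_apply_apply]
            rfl
          have := hh m R t ht fun i => Finset.mem_image.2 ⟨x i, Finset.mem_univ _, (hp i).symm⟩
          have e' : h ∘ t = (fun y => h (z y)) ∘ x := by
            ext i
            exact hν _ _ ((hp i).trans (hz _).symm)
              (Finset.mem_image.2 ⟨x i, Finset.mem_univ _, (hp i).symm⟩)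
          rw [e'] at this
          exact this }
    exact ((hF Y).1 ⟨j'⟩ Y hY).elim (FirstOrder.Language.Hom.id L _)⟩
  refine ⟨fun x => if hx : x ∈ Set.range ν then j (e ⟨x, hx⟩) else Classical.arbitrary B,
    fun m R t ht => ?_⟩
  have := j.map_rel R (fun i => e (Set.rangeFactorization ν (t i))) ⟨t, ht, fun i => rfl⟩
  change FirstOrder.Language.Structure.RelMap R _
  convert this using 1
  ext i
  exact dif_pos (Set.mem_range_self _)

theorem IsCanonicalStructure.smul_mem {k : ℕ} {G : Subgroup (Equiv.Perm B)}
    (hL : IsCanonicalStructure L B k G) :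
    PreservesRels L G := by
  intro r R g hg y hy
  by_cases hr : r = k
  · subst hr
    obtain ⟨c, -, hc⟩ := hL.isOrbit R
    rw [hc] at hy ⊢
    obtain ⟨g', rfl⟩ := hy
    exact ⟨⟨g, hg⟩ * g', by ext i; simp [mul_smul, Subgroup.smul_def]⟩
  · exact ((hL.arity r hr).false R).elim

/-- Every orbit of injective `k`-tuples is named by a relation, so preserving relations means
preserving these orbits, and homogeneity applies. -/
theorem IsCanonicalStructure.exists_map_eq {k : ℕ} {G : Subgroup (Equiv.Perm B)}
    (hL : IsCanonicalStructure L B k G) (hG : IsNeoliberalGroup k G) {V : Type*} (U : Finset V)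
    (hU : k ≤ U.card) {f f' : V → B} (hf : Set.InjOn f U)
    (h : ∀ (R : L.Relations k) (y : Fin k → V), (∀ i, y i ∈ U) → f ∘ y ∈ relOf B R →
      f' ∘ y ∈ relOf B R) : ∃ g ∈ G, ∀ x ∈ U, g (f x) = f' x := by
  refine hG.exists_map_eq_of_forall U hU fun y hy hyU => ?_
  obtain ⟨R, hR, -⟩ := hL.named (f ∘ y) fun i j hij => hy (hf (hyU i) (hyU j) hij)
  have := h R y hyU (hR ▸ MulAction.mem_orbit_self _)
  rw [hR] at this
  obtain ⟨g, hg⟩ := this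
  exact ⟨g, g.2, fun i => congrFun hg i⟩

end Duality

/-! ### Chains of assignments -/

section Chain

variable {B : Type w} {V : Type}

/-- Some member of `Φ` agrees with `p` on `U` and with `q` on `U'`. -/
def Link (U U' : Finset V) (Φ : Set (V → B)) (p q : V → B) : Prop :=
  ∃ f ∈ Φ, (∀ x ∈ U, f x = p x) ∧ ∀ x ∈ U', f x = q x

/-- There is a chain of `n` links from `p` to `q`. -/
def Chain (U : ℕ → Finset V) (Φ : ℕ → Set (V → B)) : ℕ → (V → B) → (V → B) → Prop
  | 0, p, q => p = q
  | n + 1, p, q => ∃ r, Chain U Φ n p r ∧ Link (U n) (U (n + 1)) (Φ n) r q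

theorem chain_iff {U : ℕ → Finset V} {Φ : ℕ → Set (V → B)} {n : ℕ} {p q : V → B} :
    Chain U Φ n p q ↔ ∃ s : ℕ → V → B, s 0 = p ∧ s n = q ∧
      ∀ t < n, Link (U t) (U (t + 1)) (Φ t) (s t) (s (t + 1)) := by
  induction n generalizing q with
  | zero =>
    constructor
    · rintro rfl
      exact ⟨fun _ => p, rfl, rfl, by simp⟩
    · rintro ⟨s, rfl, rfl, -⟩
      rfl
  | succ n ih =>
    constructor
    · rintro ⟨r, hr, hl⟩
      obtain ⟨s, rfl, rfl, hs⟩ := ih.1 hr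
      refine ⟨fun t => if t = n + 1 then q else s t, by simp, by simp, fun t ht => ?_⟩
      rcases Nat.lt_succ_iff_lt_or_eq.1 ht with h | rfl
      · simpa [h.ne, show t ≠ n + 1 by omega] using hs t h
      · simpa using hl
    · rintro ⟨s, rfl, rfl, hs⟩
      exact ⟨s n, ih.2 ⟨s, rfl, rfl, fun t ht => hs t (by omega)⟩, hs n (by omega)⟩

/-- The number of times up to `t` at which `x` is missing. -/
def gapCount [DecidableEq V] (U : ℕ → Finset V) (x : V) (t : ℕ) : ℕ :=
  ((Finset.range (t + 1)).filter fun s => x ∉ U s).card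

variable [DecidableEq V] {U : ℕ → Finset V} {x : V}

theorem gapCount_succ_of_mem {t : ℕ} (h : x ∈ U (t + 1)) : gapCount U x (t + 1) = gapCount U x t := by
  rw [gapCount, Finset.range_add_one, Finset.filter_insert]
  simp [h, gapCount]

theorem gapCount_mono : Monotone (gapCount U x) := fun t t' h =>
  Finset.card_le_card (Finset.filter_subset_filter _ (Finset.range_subset_range.2 (by omega)))

theorem gapCount_lt {t s t' : ℕ} (hts : t < s) (hst : s ≤ t') (hs : x ∉ U s) :
    gapCount U x t < gapCount U x t' := by
  refine Finset.card_lt_card ⟨Finset.filter_subset_filter _ (Finset.range_subset_range.2 (by omega)),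
    fun h => ?_⟩
  have := h (Finset.mem_filter.2 ⟨Finset.mem_range.2 (show s < t' + 1 by omega), hs⟩)
  simp at this
  omega

theorem mem_of_gapCount_eq {t s t' : ℕ} (h : gapCount U x t = gapCount U x t') (hts : t < s)
    (hst : s ≤ t') : x ∈ U s := by
  by_contra hs
  exact (gapCount_lt hts hst hs).ne h

end Chain

/-! ### Rerouting chains by finite duality -/

section Connect

variable {L : FirstOrder.Language.{u, v}} {B : Type w} [L.Structure B] {V : Type}

theorem Link.congr {U U' : Finset V} {Φ : Set (V → B)} {p q p' q' : V → B}
    (h : Link U U' Φ p q) (hp : ∀ x ∈ U, p x = p' x) (hq : ∀ x ∈ U', q x = q' x) :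
    Link U U' Φ p' q' := by
  obtain ⟨f, hf, h₁, h₂⟩ := h
  exact ⟨f, hf, fun x hx => (h₁ x hx).trans (hp x hx), fun x hx => (h₂ x hx).trans (hq x hx)⟩

theorem eq_of_forall_mem {U : ℕ → Finset V} {s : ℕ → V → B} {n : ℕ}
    (hs : ∀ t < n, ∀ x ∈ U t, x ∈ U (t + 1) → s t x = s (t + 1) x) {x : V} {t t' : ℕ} (htt : t ≤ t')
    (ht' : t' ≤ n) (hx : ∀ r, t ≤ r → r ≤ t' → x ∈ U r) : s t x = s t' x := by
  induction t', htt using Nat.le_induction with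
  | base => rfl
  | succ t' h ih =>
    exact (ih (by omega) fun r h₁ h₂ => hx r h₁ (by omega)).trans
      (hs t' (by omega) x (hx _ h (by omega)) (hx _ (by omega) le_rfl))

/-- Long chains can be rerouted such that their ends are arbitrary members of the respective orbits,
as long as these agree on the variables that are present throughout. -/
theorem Chain.connect [Finite V] {k d : ℕ} {G : Subgroup (Equiv.Perm B)}
    (hG : IsNeoliberalGroup k G) (hL : IsCanonicalStructure L B k G)
    (hd : IsLocallySatisfiable L B d) {U : ℕ → Finset V} {Φ : ℕ → Set (V → B)}
    (hU : ∀ t, (U t).card = k)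
    (hinj : ∀ t, ∀ f ∈ Φ t, ∀ x y, (x ∈ U t ∨ x ∈ U (t + 1)) → (y ∈ U t ∨ y ∈ U (t + 1)) →
      f x = f y → x = y)
    (hΦ : ∀ t, ∀ f ∈ Φ t, ∀ g ∈ G, g ∘ f ∈ Φ t) (S : Finset V) (hS : ∀ t, S ⊆ U t) {m : ℕ}
    (hm : 0 < m) (hgap : ∀ x ∉ S, ∀ i, ∃ t, i * m < t ∧ t ≤ (i + 1) * m ∧ x ∉ U t) {n : ℕ}
    (hn : (d + 2) * m ≤ n) {p q a b : V → B} (hpq : Chain U Φ n p q)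
    (ha : ∃ g ∈ G, ∀ x ∈ U 0, g (p x) = a x) (hb : ∃ g ∈ G, ∀ x ∈ U n, g (q x) = b x)
    (hab : ∀ x ∈ S, a x = b x) : Chain U Φ n a b := by
  classical
  obtain ⟨s, rfl, rfl, hs⟩ := chain_iff.1 hpq
  obtain ⟨α, hα, ha⟩ := ha
  obtain ⟨β, hβ, hb⟩ := hb
  have : Nonempty (V → B) := ⟨a⟩
  choose! f hfΦ hf₀ hf₁ using hs
  have hss : ∀ t < n, ∀ x ∈ U t, x ∈ U (t + 1) → s t x = s (t + 1) x := fun t ht x h₀ h₁ =>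
    (hf₀ t ht x h₀).symm.trans (hf₁ t ht x h₁)
  have hrun : ∀ {x t t'}, t ≤ t' → t' ≤ n → (∀ r, t ≤ r → r ≤ t' → x ∈ U r) → s t x = s t' x :=
    fun htt ht' hx => eq_of_forall_mem hss htt ht' hx
  have hn0 : 0 < n := lt_of_lt_of_le (Nat.mul_pos (by omega) hm) hn
  -- The unknowns are copies of the constants in `K` and the occurrences `(x, t)` of variables. The
  -- class map `μ` merges the occurrences of `x` in one uninterrupted run; a run touching time `0`
  -- or `n`, or one of a variable in `S`, is merged with the prescribed constant.
  let K : Finset B := (U 0).image a ∪ (U n).image b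
  let Z : Type w := {c // c ∈ K} ⊕ {z : V × Fin (n + 1) // z.1 ∈ U z.2}
  let μ : V → ℕ → B ⊕ (V × ℕ) := fun x t =>
    if x ∈ S ∨ gapCount U x t = 0 then Sum.inl (a x)
    else if gapCount U x t = gapCount U x n then Sum.inl (b x) else Sum.inr (x, gapCount U x t)
  let ν : Z → B ⊕ (V × ℕ) := Sum.elim (fun c => Sum.inl c.1) fun z => μ z.1.1 z.1.2
  have hμ : ∀ {x t}, x ∈ U (t + 1) → μ x (t + 1) = μ x t := fun {x t} hx => by
    simp only [μ, gapCount_succ_of_mem hx]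
  -- The constraints are all relations on `K`, and the relations of the links
  let At : ∀ r, L.Relations r → Set (Fin r → Z) := fun r R =>
    {y | (∃ c : Fin r → {c // c ∈ K}, y = Sum.inl ∘ c ∧ Subtype.val ∘ c ∈ relOf B R) ∨
      ∃ t < n, ∃ z : Fin r → {z : V × Fin (n + 1) // z.1 ∈ U z.2}, y = Sum.inr ∘ z ∧
        (∀ i, ((z i).1.2 : ℕ) = t ∨ ((z i).1.2 : ℕ) = t + 1) ∧
          (fun i => f t (z i).1.1) ∈ relOf B R}
  have hcanon : ∀ {r : ℕ} (R : L.Relations r) {y : Fin r → B}, y ∈ relOf B R → ∀ g ∈ G,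
      (fun i => g (y i)) ∈ relOf B R :=
    fun R _ hy g hg => hL.smul_mem _ R g hg _ hy
  obtain ⟨H, hH⟩ := hd Z (B ⊕ (V × ℕ)) ν At fun D hD => by
    -- The cut is sought among the `d + 1` times `m, 2m, …, (d + 1)m`. A run outside `S` contains at
    -- most one of them, since every window of length `m` has a gap; so the at most `d` classes in
    -- `D` cannot block all of them.
    obtain ⟨c, hcn, hcm, hcm', hc⟩ : ∃ c < n, m ≤ c ∧ c ≤ (d + 1) * m ∧
        ∀ x ∉ S, x ∈ U c → μ x c ∉ D := by
      by_contra! hcon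
      have h₁ : ∀ i : Fin (d + 1), (i.1 + 1) * m ≤ (d + 1) * m := fun i =>
        Nat.mul_le_mul_right m (by omega)
      have h₂ : (d + 1) * m < n := by nlinarith
      have h₃ : ∀ i : Fin (d + 1), m ≤ (i.1 + 1) * m := fun i => by nlinarith
      choose x hxS hxU hxD using fun i : Fin (d + 1) =>
        hcon ((i.1 + 1) * m) ((h₁ i).trans_lt h₂) (h₃ i) (h₁ i)
      have hμx : ∀ i, μ (x i) ((i.1 + 1) * m) =
          Sum.inr (x i, gapCount U (x i) ((i.1 + 1) * m)) := by
        intro i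
        obtain ⟨t, ht₁, ht₂, ht⟩ := hgap (x i) (hxS i) i
        obtain ⟨t', ht₁', ht₂', ht'⟩ := hgap (x i) (hxS i) (d + 1)
        have h₀ := gapCount_lt ht₁ ht₂ ht
        have h₀' := gapCount_lt (lt_of_le_of_lt (h₁ i) ht₁') (ht₂'.trans hn) ht'
        simp only [μ, hxS i, false_or]
        rw [if_neg (by omega), if_neg (by omega)]
      have := Finset.card_le_card_of_injOn (s := Finset.univ) (t := D)
        (fun i : Fin (d + 1) => μ (x i) ((i.1 + 1) * m)) (fun i _ => hxD i) (by
          intro i _ j _ hij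
          simp only [hμx, Sum.inr.injEq, Prod.mk.injEq] at hij
          have key : ∀ i j : Fin (d + 1), i < j → x i = x j →
              gapCount U (x i) ((i.1 + 1) * m) ≠ gapCount U (x j) ((j.1 + 1) * m) := by
            intro i j hlt hx
            obtain ⟨t, ht₁, ht₂, ht⟩ := hgap (x i) (hxS i) (i + 1)
            have : (i.1 + 1 + 1) * m ≤ (j.1 + 1) * m := Nat.mul_le_mul_right m (by
              have : i.1 < j.1 := hlt
              omega)
            rw [← hx]
            exact (gapCount_lt ht₁ (ht₂.trans this) ht).ne
          rcases lt_trichotomy i j with h | h | h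
          exacts [absurd hij.2 (key i j h hij.1), h, absurd hij.2.symm (key j i h hij.1.symm)])
      rw [Finset.card_univ, Fintype.card_fin] at this
      omega
    -- The chain is moved by `α` up to the cut and by `β` after it. Only runs crossing the cut are
    -- torn: those outside `S` are invisible in `D`, and on `S` both translates agree.
    let h : V → ℕ → B := fun x t => if t ≤ c then α (s t x) else β (s t x)
    have hS' : ∀ x ∈ S, ∀ t ≤ n, h x t = a x := by
      intro x hx t ht
      have h₀ := hrun (Nat.zero_le t) ht fun r _ _ => hS r hx
      have h₁ := hrun ht le_rfl fun r _ _ => hS r hx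
      by_cases htc : t ≤ c
      · simp only [h, if_pos htc]
        rw [← h₀, ha x (hS 0 hx)]
      · simp only [h, if_neg htc]
        rw [h₁, hb x (hS n hx), hab x hx]
    have hinl : ∀ x t, x ∈ U t → t ≤ n → ∀ e, μ x t = Sum.inl e → h x t = e := by
      intro x t hx ht e he
      by_cases hxS : x ∈ S
      · simp only [μ, hxS, true_or, if_true, Sum.inl.injEq] at he
        rw [hS' x hxS t ht, he]
      by_cases h0 : gapCount U x t = 0
      · simp only [μ, h0, or_true, if_true, Sum.inl.injEq] at he
        obtain ⟨t', ht₁, ht₂, ht'⟩ := hgap x hxS 0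
        have htc : t ≤ c := by
          by_contra hlt
          have := gapCount_lt (t := 0) (s := t') (t' := t) (U := U) (x := x) (by omega)
            (by rw [Nat.zero_add, one_mul] at ht₂; omega) ht'
          omega
        have h00 : gapCount U x 0 = 0 :=
          Nat.le_zero.1 ((gapCount_mono (Nat.zero_le t)).trans h0.le)
        have hx0 : x ∈ U 0 := by
          by_contra hx0
          have : gapCount U x 0 ≠ 0 := by simp [gapCount, hx0]
          exact this h00
        have := hrun (Nat.zero_le t) ht fun r hr₀ hr => by
          rcases Nat.eq_zero_or_pos r with rfl | hr'
          · exact hx0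
          · exact mem_of_gapCount_eq (h00.trans h0.symm) hr' hr
        simp only [h, if_pos htc]
        rw [← this, ha x hx0, he]
      · by_cases h1 : gapCount U x t = gapCount U x n
        · simp only [μ] at he
          rw [if_neg (by simp [hxS, h0]), if_pos h1] at he
          obtain ⟨t', ht₁, ht₂, ht'⟩ := hgap x hxS (d + 1)
          have htc : ¬ t ≤ c := fun htc => (gapCount_lt (t := t) (s := t') (t' := n) (U := U) (x := x)
            (by omega) (ht₂.trans hn) ht').ne h1
          have hxr : ∀ r, t ≤ r → r ≤ n → x ∈ U r := fun r hr hrn => by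
            rcases hr.lt_or_eq with hr | rfl
            · exact mem_of_gapCount_eq h1 hr hrn
            · exact hx
          have := hrun ht le_rfl hxr
          simp only [h, if_neg htc]
          rw [this, hb x (hxr n ht le_rfl)]
          exact Sum.inl.inj he
        · simp [μ, hxS, h0, h1] at he
    have hinr : ∀ x t t', t ≤ t' → t' ≤ n → x ∈ U t → x ∈ U t' →
        gapCount U x t = gapCount U x t' → x ∉ S → μ x t ∈ D → h x t = h x t' := by
      intro x t t' htt ht' hx hx' hτ hxS hD
      have hxr : ∀ r, t ≤ r → r ≤ t' → x ∈ U r := fun r hr hrn => by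
        rcases hr.lt_or_eq with hr | rfl
        · exact mem_of_gapCount_eq hτ hr hrn
        · exact hx
      have := hrun htt ht' hxr
      by_cases h₁ : t' ≤ c
      · simp only [h, if_pos h₁, if_pos (htt.trans h₁), this]
      · by_cases h₂ : t ≤ c
        · refine (hc x hxS (hxr c h₂ (by omega)) ?_).elim
          have e₁ : gapCount U x c = gapCount U x t := le_antisymm
            (hτ ▸ gapCount_mono (by omega)) (gapCount_mono h₂)
          have : μ x c = μ x t := by simp only [μ, e₁]
          rwa [this]
        · simp only [h, if_neg h₁, if_neg h₂, this]
    refine ⟨Sum.elim Subtype.val fun z => h z.1.1 z.1.2, ?_, ?_⟩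
    · rintro (⟨e, he⟩ | ⟨⟨x, t⟩, hx⟩) (⟨e', he'⟩ | ⟨⟨x', t'⟩, hx'⟩) hνν hνD
      · exact Sum.inl.inj hνν
      · exact (hinl x' t' hx' (Nat.lt_succ_iff.1 t'.2) e hνν.symm).symm
      · exact hinl x t hx (Nat.lt_succ_iff.1 t.2) e' hνν
      · change h x t = h x' t'
        change μ x t = μ x' t' at hνν
        change μ x t ∈ D at hνD
        rcases hμx : μ x t with e | ⟨x₀, τ⟩
        · rw [hinl x t hx (Nat.lt_succ_iff.1 t.2) e hμx,
            hinl x' t' hx' (Nat.lt_succ_iff.1 t'.2) e (hνν ▸ hμx)]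
        · have hμr : ∀ x t, μ x t = Sum.inr (x₀, τ) → x ∉ S ∧ x = x₀ ∧ gapCount U x t = τ := by
            intro x t hxt
            simp only [μ] at hxt
            split_ifs at hxt with h₁ h₂
            push Not at h₁
            exact ⟨h₁.1, (Prod.mk.inj (Sum.inr.inj hxt)).1, (Prod.mk.inj (Sum.inr.inj hxt)).2⟩
          obtain ⟨hxS, rfl, hτ⟩ := hμr x t hμx
          obtain ⟨-, rfl, hτ'⟩ := hμr x' t' (hνν ▸ hμx)
          rcases le_total (t : ℕ) t' with htt | htt
          · exact hinr _ _ _ htt (Nat.lt_succ_iff.1 t'.2) hx hx' (hτ.trans hτ'.symm) hxS hνD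
          · exact (hinr _ _ _ htt (Nat.lt_succ_iff.1 t.2) hx' hx (hτ'.trans hτ.symm) hxS
              (hνν ▸ hνD)).symm
    · rintro r R y (⟨c', rfl, hc'⟩ | ⟨t, ht, z, rfl, hz, hzR⟩) hyD
      · exact hc'
      · change (fun i => h (z i).1.1 (z i).1.2) ∈ relOf B R
        have hval : ∀ i, s (z i).1.2 (z i).1.1 = f t (z i).1.1 := by
          intro i
          have hzU := (z i).2
          rcases hz i with h' | h' <;> rw [h'] at hzU ⊢
          · exact (hf₀ t ht _ hzU).symm
          · exact (hf₁ t ht _ hzU).symm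
        rcases lt_trichotomy t c with htc | rfl | htc
        · convert hcanon R hzR α hα using 1
          ext i
          have : ((z i).1.2 : ℕ) ≤ c := by rcases hz i with h' | h' <;> omega
          simp only [h, if_pos this, hval]
        · convert hcanon R hzR β hβ using 1
          ext i
          rcases hz i with h' | h'
          · have hxS : (z i).1.1 ∈ S := by
              by_contra hxS
              have hzU := (z i).2
              have hzD := hyD i
              change μ (z i).1.1 (z i).1.2 ∈ D at hzD
              rw [h'] at hzU hzD
              exact hc _ hxS hzU hzD
            rw [hS' _ hxS _ (by omega), ← hval i, h',
              hrun ht.le le_rfl fun r _ _ => hS r hxS, hb _ (hS n hxS), hab _ hxS]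
          · have : ¬ ((z i).1.2 : ℕ) ≤ t := by omega
            simp only [h, if_neg this, hval]
        · convert hcanon R hzR β hβ using 1
          ext i
          have : ¬ ((z i).1.2 : ℕ) ≤ c := by rcases hz i with h' | h' <;> omega
          simp only [h, if_neg this, hval]
  have hs₀ : ∀ x ∈ U 0, f 0 x = s 0 x := hf₀ 0 hn0
  have hainj : Set.InjOn a (U 0) := by
    intro x hx y hy hxy
    rw [← ha x hx, ← ha y hy, ← hs₀ x hx, ← hs₀ y hy] at hxy
    exact hinj 0 _ (hfΦ 0 hn0) x y (.inl hx) (.inl hy) (α.injective hxy)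
  -- All relations among the constants were imposed, so `H` acts on `K` like a group element, whose
  -- inverse restores the prescribed ends.
  obtain ⟨γ, hγ, hγK⟩ := hL.exists_map_eq hG K (f := id) (f' := fun e => H (Sum.inl e))
    (by
      rw [← hU 0, ← Finset.card_image_of_injOn hainj]
      exact Finset.card_le_card Finset.subset_union_left)
    Function.injective_id.injOn fun R y hy hyR =>
      hH k R (fun i => Sum.inl ⟨y i, hy i⟩) (.inl ⟨fun i => ⟨y i, hy i⟩, rfl, hyR⟩)
  let s' : ℕ → V → B := fun t x => (γ⁻¹ : Equiv.Perm B) (H (μ x t))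
  have hs_zero : ∀ x ∈ U 0, s' 0 x = a x := by
    intro x hx
    have h0 : gapCount U x 0 = 0 := by simp [gapCount, hx]
    have : μ x 0 = Sum.inl (a x) := by simp [μ, h0]
    simp only [s', this]
    rw [← hγK (a x) (Finset.mem_union_left _ (Finset.mem_image_of_mem _ hx))]
    simp
  have hs_last : ∀ x ∈ U n, s' n x = b x := by
    intro x hx
    have : μ x n = Sum.inl (b x) := by
      by_cases hxS : x ∈ S
      · simp [μ, hxS, hab x hxS]
      · obtain ⟨t, ht₁, ht₂, ht⟩ := hgap x hxS 0
        have := gapCount_lt (t := 0) (s := t) (t' := n) (U := U) (x := x) (by omega)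
          (by nlinarith) ht
        simp [μ, hxS, show gapCount U x n ≠ 0 by omega]
    simp only [s', this]
    rw [← hγK (b x) (Finset.mem_union_right _ (Finset.mem_image_of_mem _ hx))]
    simp
  have hlink : ∀ t < n, Link (U t) (U (t + 1)) (Φ t) (s' t) (s' (t + 1)) := by
    intro t ht
    obtain ⟨g, hg, hgf⟩ := hL.exists_map_eq hG (U t ∪ U (t + 1)) (f := f t)
      (f' := fun x => H (μ x t)) (hU t ▸ Finset.card_le_card Finset.subset_union_left)
      (fun x hx y hy hxy => hinj t _ (hfΦ t ht) x y (Finset.mem_union.1 hx) (Finset.mem_union.1 hy)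
        hxy) fun R y hy hyR => by
        have := hH k R (fun i => Sum.inr (if h : y i ∈ U t
            then ⟨(y i, ⟨t, by omega⟩), h⟩
            else ⟨(y i, ⟨t + 1, by omega⟩), (Finset.mem_union.1 (hy i)).resolve_left h⟩)) (.inr ⟨t, ht, _, rfl,
              fun i => by
                split_ifs
                exacts [.inl rfl, .inr rfl], by
              convert hyR using 1
              ext i
              simp only [Function.comp_apply]
              split_ifs <;> rfl⟩)
        convert this using 1
        ext i
        simp only [Function.comp_apply, ν, Sum.elim_inr]
        split_ifs with h
        · rfl
        · rw [← hμ ((Finset.mem_union.1 (hy i)).resolve_left h)]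
    refine ⟨_, hΦ t _ (hΦ t _ (hfΦ t ht) g hg) _ (G.inv_mem hγ), fun x hx => ?_, fun x hx => ?_⟩
    · exact congrArg _ (hgf x (Finset.mem_union_left _ hx))
    · simp only [s', hμ hx]
      exact congrArg _ (hgf x (Finset.mem_union_right _ hx))
  -- A chain starts and ends at entire assignments, whereas links see only the sets `U t`; hence the
  -- two ends are overwritten by `a` and `b`.
  refine chain_iff.2 ⟨fun t => if t = 0 then a else if t = n then b else s' t, by simp,
    by simp [hn0.ne'], fun t ht => (hlink t ht).congr (fun x hx => ?_) fun x hx => ?_⟩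
  · by_cases h : t = 0
    · subst h
      simpa using hs_zero x hx
    · simp [h, ht.ne]
  · by_cases h : t + 1 = n
    · subst h
      simpa using hs_last x hx
    · simp [h]

end Connect

/-! ### Definability, composition and recurrence of chains -/

section ChainLemmas

variable {L : FirstOrder.Language.{u, v}} {B : Type w} [L.Structure B] {V : Type}

theorem isPP_link [Finite V] (U U' : Finset V) {Φ : Set (V → B)} (hΦ : IsPP L Φ) :
    IsPP L {H : Bool × V → B | Link U U' Φ (H ∘ Prod.mk false) (H ∘ Prod.mk true)} := by
  have := (((hΦ.reindex (Sum.inr : V → (Bool × V) ⊕ V)).inter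
    (IsPP.finset_iInter U fun x _ => IsPP.eq (Sum.inr x) (Sum.inl (false, x)))).inter
    (IsPP.finset_iInter U' fun x _ => IsPP.eq (Sum.inr x) (Sum.inl (true, x)))).image
      (Sum.inl : Bool × V → (Bool × V) ⊕ V)
  convert this using 1
  ext H
  constructor
  · rintro ⟨f, hf, h₀, h₁⟩
    exact ⟨Sum.elim H f, ⟨⟨hf, h₀⟩, h₁⟩, rfl⟩
  · rintro ⟨H, ⟨⟨hf, h₀⟩, h₁⟩, rfl⟩
    exact ⟨_, hf, h₀, h₁⟩

theorem isPP_chain [Finite V] (U : ℕ → Finset V) {Φ : ℕ → Set (V → B)} (hΦ : ∀ t, IsPP L (Φ t))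
    (n : ℕ) : IsPP L {H : Bool × V → B | Chain U Φ n (H ∘ Prod.mk false) (H ∘ Prod.mk true)} := by
  induction n with
  | zero =>
    have := IsPP.iInter (L := L) (A := B) fun x : V => IsPP.eq ((false, x) : Bool × V) (true, x)
    convert this using 1
    ext H
    exact funext_iff
  | succ n ih =>
    have := ((ih.reindex (fun z : Bool × V => if z.1 then (Sum.inr z.2 : (Bool × V) ⊕ V)
      else Sum.inl (false, z.2))).inter ((isPP_link (U n) (U (n + 1)) (hΦ n)).reindex
        (fun z : Bool × V => if z.1 then (Sum.inl (true, z.2) : (Bool × V) ⊕ V)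
          else Sum.inr z.2))).image (Sum.inl : Bool × V → (Bool × V) ⊕ V)
    convert this using 1
    ext H
    constructor
    · rintro ⟨r, h₀, h₁⟩
      exact ⟨Sum.elim H r, ⟨h₀, h₁⟩, rfl⟩
    · rintro ⟨H, ⟨h₀, h₁⟩, rfl⟩
      exact ⟨_, h₀, h₁⟩

theorem Chain.smul {U : ℕ → Finset V} {Φ : ℕ → Set (V → B)} {G : Subgroup (Equiv.Perm B)}
    (hΦ : ∀ t, ∀ f ∈ Φ t, ∀ g ∈ G, g ∘ f ∈ Φ t) {n : ℕ} {p q : V → B} (h : Chain U Φ n p q)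
    {g : Equiv.Perm B} (hg : g ∈ G) : Chain U Φ n (g ∘ p) (g ∘ q) := by
  induction n generalizing q with
  | zero => exact congrArg _ h
  | succ n ih =>
    obtain ⟨r, hr, f, hf, h₀, h₁⟩ := h
    exact ⟨g ∘ r, ih hr, g ∘ f, hΦ n f hf g hg, fun x hx => congrArg g (h₀ x hx),
      fun x hx => congrArg g (h₁ x hx)⟩

theorem Chain.add {U : ℕ → Finset V} {Φ : ℕ → Set (V → B)} {n m : ℕ}
    (hU : ∀ t, U (n + t) = U t) (hΦ : ∀ t, Φ (n + t) = Φ t) {p q r : V → B}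
    (h : Chain U Φ n p q) (h' : Chain U Φ m q r) : Chain U Φ (n + m) p r := by
  induction m generalizing r with
  | zero =>
    obtain rfl : q = r := h'
    exact h
  | succ m ih =>
    obtain ⟨s, hs, hl⟩ := h'
    refine ⟨s, ih hs, ?_⟩
    change Link (U (n + m)) (U (n + (m + 1))) (Φ (n + m)) s r
    rw [hU, hU, hΦ]
    exact hl

/-- An infinite walk along `R` inside `X` meets some orbit of assignments twice, since there are
only finitely many. -/
theorem exists_return [Finite V] {G : Subgroup (Equiv.Perm B)} (hG : IsOligomorphic G)
    {X : Set (V → B)} (hX : X.Nonempty) {R : (V → B) → (V → B) → Prop}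
    (hR : ∀ h ∈ X, ∃ h' ∈ X, R h h') :
    ∃ (s : ℕ → V → B) (i j : ℕ), i < j ∧ (∀ l, s l ∈ X ∧ R (s l) (s (l + 1))) ∧
      ∃ g ∈ G, s j = g ∘ s i := by
  obtain ⟨h₀, hh₀⟩ := hX
  choose! next hnext hRnext using hR
  let s : ℕ → V → B := fun l => next^[l] h₀
  have hs : ∀ l, s l ∈ X := fun l => by
    induction l with
    | zero => exact hh₀
    | succ l ih =>
      simp only [s, Function.iterate_succ_apply']
      exact hnext _ ih
  have hs' : ∀ l, s l ∈ X ∧ R (s l) (s (l + 1)) := fun l => by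
    refine ⟨hs l, ?_⟩
    simp only [s, Function.iterate_succ_apply']
    exact hRnext _ (hs l)
  obtain ⟨n, ⟨e⟩⟩ := Finite.exists_equiv_fin V
  have := hG n
  obtain ⟨i, j, hij, h⟩ := Finite.exists_ne_map_eq_of_infinite fun l : ℕ =>
    (Quotient.mk'' (s l ∘ e.symm) : MulAction.orbitRel.Quotient G (Fin n → B))
  have key : ∀ {i j}, (Quotient.mk'' (s i ∘ e.symm) : MulAction.orbitRel.Quotient G (Fin n → B)) =
      Quotient.mk'' (s j ∘ e.symm) → ∃ g ∈ G, s i = g ∘ s j := by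
    intro i j h
    obtain ⟨g, hg⟩ := MulAction.orbitRel_apply.1 (Quotient.eq''.1 h)
    refine ⟨g, g.2, funext fun x => ?_⟩
    have := congrFun hg (e x)
    simpa [Subgroup.smul_def] using this.symm
  rcases hij.lt_or_gt with hlt | hlt
  · exact ⟨s, i, j, hlt, hs', key h.symm⟩
  · exact ⟨s, j, i, hlt, hs', key h⟩

end ChainLemmas

/-- Implications between the values on `k`-element sets of variables do not form a non-trivial
cycle. -/
theorem IsDecomposableTemplate.no_implication_cycle {L : FirstOrder.Language.{u, v}}
    {L' : FirstOrder.Language.{u', v'}} {B : Type w} [L.Structure B] [L'.Structure B] {k N d : ℕ}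
    {G : Subgroup (Equiv.Perm B)} (hT : IsDecomposableTemplate L' k N G)
    (hL : IsCanonicalStructure L B k G) (hd : IsLocallySatisfiable L B d) {V : Type} [Finite V]
    {U : ℕ → Finset V} {Φ C : ℕ → Set (V → B)} {m : ℕ} (hm : 0 < m)
    (hUm : ∀ t, U (t + m) = U t) (hΦm : ∀ t, Φ (t + m) = Φ t) (hCm : ∀ t, C (t + m) = C t)
    (hU : ∀ t, (U t).card = k) (hΦ : ∀ t, IsPP L' (Φ t))
    (hinj : ∀ t, ∀ f ∈ Φ t, ∀ x y, (x ∈ U t ∨ x ∈ U (t + 1)) → (y ∈ U t ∨ y ∈ U (t + 1)) →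
      f x = f y → x = y)
    (hproj : ∀ (t : ℕ) (h : V → B), (∃ f ∈ Φ t, ∀ x ∈ U (t + 1), f x = h x) ↔
      ∃ f ∈ Φ (t + 1), ∀ x ∈ U (t + 1), f x = h x)
    (hCdep : ∀ t f f', (∀ x ∈ U t, f x = f' x) → f ∈ C t → f' ∈ C t)
    (hCG : ∀ t, ∀ f ∈ C t, ∀ g ∈ G, g ∘ f ∈ C t)
    (himp : ∀ t, ∀ f ∈ Φ t, f ∈ C t → f ∈ C (t + 1))
    (hin : ∃ f ∈ Φ 0, f ∈ C 0) (hout : ∃ f ∈ Φ 0, f ∉ C 0) (hne : ∃ t, U t ≠ U 0) : False := by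
  classical
  have := Fintype.ofFinite V
  have hk := hT.three_le
  have hG := hT.neoliberal
  have hΦG : ∀ t, ∀ f ∈ Φ t, ∀ g ∈ G, g ∘ f ∈ Φ t := fun t f hf g hg => hT.smul_mem (hΦ t) hg hf
  have hper : ∀ {β : Type w} (X : ℕ → β), (∀ t, X (t + m) = X t) → ∀ i t, X (i * m + t) = X t := by
    intro β X hX i t
    induction i with
    | zero => simp
    | succ i ih => rw [← ih, ← hX (i * m + t)]; congr 1; ring
  have hper' : ∀ i t, U (i * m + t) = U t := by
    intro i t
    induction i with
    | zero => simp
    | succ i ih => rw [← ih, ← hUm (i * m + t)]; congr 1; ring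
  have hperΦ := hper Φ hΦm
  have hperC := hper C hCm
  let D : ℕ → Set (V → B) := fun t => {h | ∃ f ∈ Φ t, ∀ x ∈ U t, f x = h x}
  have hDm : ∀ i, D (i * m) = D 0 := fun i => by
    have h₁ := hperΦ i 0
    have h₂ := hper' i 0
    rw [add_zero] at h₁ h₂
    simp only [D, h₁, h₂]
  have hCm' : ∀ i, C (i * m) = C 0 := fun i => hperC i 0
  -- Walk forwards inside `C` and backwards outside of `C`
  have hfwd : ∀ n, ∀ h ∈ D 0 ∩ C 0, ∃ h' ∈ D n ∩ C n, Chain U Φ n h h' := by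
    intro n h hh
    induction n with
    | zero => exact ⟨h, hh, rfl⟩
    | succ n ih =>
      obtain ⟨r, ⟨⟨f, hf, hfr⟩, hrC⟩, hr⟩ := ih
      have hfC := hCdep n r f (fun x hx => (hfr x hx).symm) hrC
      exact ⟨f, ⟨(hproj n f).1 ⟨f, hf, fun _ _ => rfl⟩, himp n f hf hfC⟩, r, hr, f, hf, hfr,
        fun _ _ => rfl⟩
  have hbwd : ∀ n, ∀ h ∈ D n \ C n, ∃ h' ∈ D 0 \ C 0, Chain U Φ n h' h := by
    intro n
    induction n with
    | zero => exact fun h hh => ⟨h, hh, rfl⟩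
    | succ n ih =>
      rintro h ⟨hhD, hhC⟩
      obtain ⟨f, hf, hfh⟩ := (hproj n h).2 hhD
      obtain ⟨h', hh', hc⟩ := ih f ⟨⟨f, hf, fun _ _ => rfl⟩, fun hfC =>
        hhC (hCdep _ _ _ hfh (himp n f hf hfC))⟩
      exact ⟨h', hh', f, hc, f, hf, fun _ _ => rfl, hfh⟩
  have hchainC : ∀ n p q, Chain U Φ n p q → p ∈ C 0 → q ∈ C n := by
    intro n p q h hp
    induction n generalizing q with
    | zero => exact h ▸ hp
    | succ n ih =>
      obtain ⟨r, hr, f, hf, h₀, h₁⟩ := h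
      exact hCdep _ _ _ h₁ (himp n f hf (hCdep _ _ _ (fun x hx => (h₀ x hx).symm) (ih r hr)))
  have hpow : ∀ a p g, g ∈ G → Chain U Φ (a * m) p (g ∘ p) → ∀ j, ∃ g ∈ G,
      Chain U Φ (j * a * m) p (g ∘ p) := by
    intro a p g hg h j
    induction j with
    | zero => exact ⟨1, G.one_mem, by rw [zero_mul, zero_mul]; rfl⟩
    | succ j ih =>
      obtain ⟨g', hg', hj⟩ := ih
      refine ⟨g' * g, G.mul_mem hg' hg, ?_⟩
      rw [add_mul, one_mul, add_mul]
      exact hj.add (hper' _) (hperΦ _) (h.smul hΦG hg')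
  obtain ⟨p, ⟨⟨f, hfΦ, hfp⟩, hpC⟩, a, ha, hp⟩ : ∃ p ∈ D 0 ∩ C 0, ∃ a > 0, ∀ j, ∃ g ∈ G,
      Chain U Φ (j * a * m) p (g ∘ p) := by
    obtain ⟨f, hf, hfC⟩ := hin
    obtain ⟨s, i, j, hij, hs, g, hg, hgs⟩ := exists_return (X := D 0 ∩ C 0) (R := Chain U Φ m)
      hG.oligomorphic
      ⟨f, ⟨f, hf, fun _ _ => rfl⟩, hfC⟩ (fun h hh => by
        obtain ⟨h', hh', hc⟩ := hfwd m h hh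
        have h₁ := hDm 1
        have h₂ := hCm' 1
        rw [one_mul] at h₁ h₂
        exact ⟨h', h₁ ▸ h₂ ▸ hh', hc⟩)
    refine ⟨s i, (hs i).1, j - i, by omega, hpow _ _ g hg ?_⟩
    rw [← hgs]
    have : ∀ l, Chain U Φ (l * m) (s i) (s (i + l)) := by
      intro l
      induction l with
      | zero =>
        rw [zero_mul]
        rfl
      | succ l ih =>
        rw [add_mul, one_mul]
        exact ih.add (hper' _) (hperΦ _) (hs _).2
    have := this (j - i)
    rwa [Nat.add_sub_cancel' hij.le] at this
  obtain ⟨q, ⟨⟨f', hfΦ', hfq⟩, hqC⟩, b, hb, hq⟩ : ∃ q ∈ D 0 \ C 0, ∃ b > 0, ∀ j, ∃ g ∈ G,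
      Chain U Φ (j * b * m) q (g ∘ q) := by
    obtain ⟨f, hf, hfC⟩ := hout
    obtain ⟨s, i, j, hij, hs, g, hg, hgs⟩ := exists_return (X := D 0 \ C 0)
      (R := fun h h' => Chain U Φ m h' h)
      hG.oligomorphic ⟨f, ⟨f, hf, fun _ _ => rfl⟩, hfC⟩ (fun h hh => by
        have h₁ := hDm 1
        have h₂ := hCm' 1
        rw [one_mul] at h₁ h₂
        obtain ⟨h', hh', hc⟩ := hbwd m h (by rwa [h₁, h₂])
        exact ⟨h', hh', hc⟩)
    refine ⟨s j, (hs j).1, j - i, by omega, hpow _ _ g⁻¹ (G.inv_mem hg) ?_⟩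
    have e : (g⁻¹ : Equiv.Perm B) ∘ s j = s i := by
      ext x
      simp [hgs]
    rw [e]
    have : ∀ l, Chain U Φ (l * m) (s (i + l)) (s i) := by
      intro l
      induction l with
      | zero =>
        rw [zero_mul]
        rfl
      | succ l ih =>
        rw [add_mul, one_mul, add_comm]
        have h₁ := hper' 1
        have h₂ := hperΦ 1
        simp only [one_mul] at h₁ h₂
        exact Chain.add h₁ h₂ (hs (i + l)).2 ih
    have := this (j - i)
    rwa [Nat.add_sub_cancel' hij.le] at this
  -- A common multiple of the return lengths of `p` and `q`, long enough for `Chain.connect`.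
  let n := (d + 2) * b * a * m
  have hn : (d + 2) * m ≤ n := by
    have : (d + 2) * 1 * 1 * m ≤ (d + 2) * b * a * m := by gcongr <;> omega
    simpa using this
  have hUn : U n = U 0 := hper' _ 0
  have hCn : C n = C 0 := hCm' _
  obtain ⟨γ, hγ, hpn⟩ : ∃ g ∈ G, Chain U Φ n p (g ∘ p) := hp _
  obtain ⟨δ, hδ, hqn⟩ : ∃ g ∈ G, Chain U Φ n q (g ∘ q) := by
    have := hq ((d + 2) * a)
    rwa [show (d + 2) * a * b * m = n by simp only [n]; ring] at this
  let S : Finset V := Finset.univ.filter fun x => ∀ t, x ∈ U t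
  have hS : ∀ t, S ⊆ U t := fun t x hx => (Finset.mem_filter.1 hx).2 t
  have hgap : ∀ x ∉ S, ∀ i, ∃ t, i * m < t ∧ t ≤ (i + 1) * m ∧ x ∉ U t := by
    intro x hx i
    have : ∃ t, x ∉ U t := by simpa [S] using hx
    obtain ⟨t, ht⟩ := this
    have ht' : x ∉ U (t % m) := by
      rw [← hper' (t / m) (t % m), Nat.div_add_mod']
      exact ht
    rcases Nat.eq_zero_or_pos (t % m) with h | h
    · refine ⟨(i + 1) * m, by nlinarith, le_rfl, ?_⟩
      have := hper' (i + 1) 0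
      rw [add_zero] at this
      rwa [this, ← h]
    · refine ⟨i * m + t % m, by omega, ?_, by rwa [hper']⟩
      have := Nat.mod_lt t hm
      rw [add_mul, one_mul]
      omega
  -- As the sets `U t` have equal size but are not all the same, some `z` in `U 0` disappears at
  -- some time. The value at `z` is the one that the gadget transports.
  obtain ⟨z, hz, hzS⟩ : ∃ z ∈ U 0, z ∉ S := by
    obtain ⟨t, ht⟩ := hne
    by_contra! hcon
    exact ht (Finset.eq_of_subset_of_card_le (fun x hx => hS t (hcon x hx))
      (by rw [hU, hU])).symm
  have hinj₀ : ∀ f ∈ Φ 0, ∀ h : V → B, (∀ x ∈ U 0, f x = h x) → Set.InjOn h (U 0) := by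
    intro f hf h hfh x hx y hy hxy
    rw [← hfh x hx, ← hfh y hy] at hxy
    exact hinj 0 f hf x y (.inl hx) (.inl hy) hxy
  have hpinj := hinj₀ f hfΦ p hfp
  have hqinj := hinj₀ f' hfΦ' q hfq
  have hB : Nontrivial B := by
    obtain ⟨x, hx, y, hy, hxy⟩ := Finset.one_lt_card.1 (show 1 < (U 0).card by rw [hU]; omega)
    exact ⟨p x, p y, fun h => hxy (hpinj hx hy h)⟩
  have hcard : ((U 0).erase z).card ≤ k - 1 := by rw [Finset.card_erase_of_mem hz, hU]
  -- After translating by `η`, the assignment `q` outside `C 0` differs from `p` inside `C 0` only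
  -- at `z`, as far as `U 0` is concerned.
  obtain ⟨η, hη, hηq⟩ := hG.exists_map_eq ((U 0).erase z) hcard
    (hqinj.mono (Finset.erase_subset _ _)) (hpinj.mono (Finset.erase_subset _ _))
  have hq'C : (η : Equiv.Perm B) ∘ q ∉ C 0 := fun h => hqC (by
    have := hCG 0 _ h _ (G.inv_mem hη)
    convert this using 1
    ext x
    simp)
  have hupd : ∀ (h : V → B), (∀ x ∈ U 0, x ≠ z → h x = p x) → ∀ x ∈ U 0,
      h x = Function.update p z (h z) x := by
    intro h hh x hx
    by_cases hxz : x = z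
    · subst hxz
      simp
    · simp [hxz, hh x hx hxz]
  have hconn : ∀ {r a b : V → B} {g : Equiv.Perm B}, g ∈ G → Chain U Φ n r (g ∘ r) →
      (∃ g ∈ G, ∀ x ∈ U 0, g (r x) = a x) → (∃ g ∈ G, ∀ x ∈ U 0, g (r x) = b x) →
      (∀ x ∈ S, a x = b x) → Chain U Φ n a b := by
    intro r a b g hg hr ha hb hab
    refine hr.connect hG hL hd hU hinj hΦG S hS hm hgap hn ha ?_ hab
    obtain ⟨g', hg', hb⟩ := hb
    refine ⟨g' * g⁻¹, G.mul_mem hg' (G.inv_mem hg), fun x hx => ?_⟩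
    rw [hUn] at hx
    rw [← hb x hx]
    simp
  have hzq : q z ∉ S.image q := by
    intro hmem
    obtain ⟨x, hx, hxz⟩ := Finset.mem_image.1 hmem
    exact hzS (hqinj (hS 0 hx) hz hxz ▸ hx)
  have hScard : (S.image q).card ≤ k - 1 := by
    refine Finset.card_image_le.trans ((Finset.card_le_card fun x hx => ?_).trans hcard)
    exact Finset.mem_erase.2 ⟨fun h => hzS (h ▸ hx), hS 0 hx⟩
  -- Since `q` and `μ ∘ q` agree on `S`, a chain leads from one to the other although their values
  -- at `z` differ. The element `ρ` below carries these two values to `p z` and `η (q z)`, which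
  -- provides the escaping member of the gadget.
  obtain ⟨μ, hμ, hμS, hμz⟩ := hG.exists_move _ hScard hzq
  have hee : p z ≠ η (q z) := fun h => hq'C (by
    refine hCdep 0 p _ (fun x hx => ?_) hpC
    by_cases hxz : x = z
    · subst hxz
      exact h
    · exact (hηq x (Finset.mem_erase.2 ⟨hxz, hx⟩)).symm)
  have hbool : ∀ a b : B, a ≠ b → Function.Injective fun s : Bool => if s then b else a := by
    rintro a b hab (_ | _) (_ | _) h
    exacts [rfl, absurd h hab, absurd h.symm hab, rfl]
  obtain ⟨ρ, hρ, hρe⟩ := hG.exists_map_eq (Finset.univ : Finset Bool)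
    (by rw [Finset.card_univ, Fintype.card_bool]; omega)
    (hbool (q z) (μ (q z)) hμz.symm).injOn (hbool (p z) (η (q z)) hee).injOn
  refine hT.decomposable.false_of_propagates (isPP_chain U hΦ n) (false, z) (true, z)
    {y | y.2 ∈ U 0 ∧ y.2 ≠ z} (fun y => p y.2) {c | Function.update p z c ∈ C 0} (e := p z)
    (e' := η (q z)) (by simpa using hpC) (fun h => hq'C ?_) ?_ ?_ ?_ ?_
  · refine hCdep 0 _ _ (fun x hx => (hupd (η ∘ q) (fun x hx hxz => ?_) x hx).symm) h
    exact hηq x (Finset.mem_erase.2 ⟨hxz, hx⟩)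
  · intro H hH hHY hHC
    have h₀ := hupd (H ∘ Prod.mk false) fun x hx hxz => hHY (false, x) ⟨hx, hxz⟩
    have h₁ := hupd (H ∘ Prod.mk true) fun x hx hxz => hHY (true, x) ⟨hx, hxz⟩
    have := hchainC n _ _ hH (hCdep 0 _ _ (fun x hx => (h₀ x hx).symm) hHC)
    rw [hCn] at this
    exact hCdep 0 _ _ h₁ this
  · exact ⟨fun y => p y.2, hconn hγ hpn ⟨1, G.one_mem, fun _ _ => rfl⟩ ⟨1, G.one_mem, fun _ _ => rfl⟩
      fun _ _ => rfl, fun _ _ => rfl, rfl, rfl⟩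
  · exact ⟨fun y => η (q y.2), hconn hδ hqn ⟨η, hη, fun _ _ => rfl⟩ ⟨η, hη, fun _ _ => rfl⟩
      fun _ _ => rfl, fun y hy => hηq _ (Finset.mem_erase.2 ⟨hy.2, hy.1⟩), rfl, rfl⟩
  · refine ⟨fun y => if y.1 then ρ (μ (q y.2)) else ρ (q y.2), hconn hδ hqn ⟨ρ, hρ, fun _ _ => rfl⟩
      ⟨ρ * μ, G.mul_mem hρ hμ, fun _ _ => rfl⟩ fun x hx => ?_, ?_, ?_⟩
    · exact congrArg ρ (hμS _ (Finset.mem_image_of_mem _ hx)).symm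
    · simpa using hρe false (Finset.mem_univ _)
    · simpa using hρe true (Finset.mem_univ _)

/-- A system of primitive positive constraints `Φ j` with scopes `W j` that consist of injective
assignments, such that any `l` variables are contained in some scope and the projections of the
constraints to common sets of `k` variables agree. -/
structure IsInjectiveSystem (L : FirstOrder.Language.{u, v}) {B : Type w} [L.Structure B] (k l : ℕ)
    {V J : Type*} (W : J → Finset V) (Φ : J → Set (V → B)) : Prop where
  dep : ∀ j f f', (∀ x ∈ W j, f x = f' x) → f ∈ Φ j → f' ∈ Φ j
  nonempty : ∀ j, (Φ j).Nonempty
  injOn : ∀ j, ∀ f ∈ Φ j, Set.InjOn f (W j)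
  cover : ∀ X : Finset V, X.Nonempty → X.card ≤ l → ∃ j, X ⊆ W j
  proj : ∀ j j' (U : Finset V), U.card = k → U ⊆ W j → U ⊆ W j' →
    ∀ f ∈ Φ j, ∃ f' ∈ Φ j', ∀ x ∈ U, f' x = f x

/-! ### Solving injective systems -/

section System

variable {L : FirstOrder.Language.{u, v}} {L' : FirstOrder.Language.{u', v'}} {B : Type w}
  [L.Structure B] [L'.Structure B] {k l N d : ℕ} {G : Subgroup (Equiv.Perm B)}

theorem IsCanonicalStructure.injective (hL : IsCanonicalStructure L B k G) {R : L.Relations k}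
    {y : Fin k → B} (hy : y ∈ relOf B R) : Function.Injective y := by
  obtain ⟨c, hc, h⟩ := hL.isOrbit R
  rw [h] at hy
  obtain ⟨g, rfl⟩ := hy
  exact (g : Equiv.Perm B).injective.comp hc

/-- If the constraints determine the orbits of all `k`-tuples, then a set of bounds of size at most
`l` yields a solution. -/
theorem IsInjectiveSystem.exists_solution_of_orbits [L.IsRelational] [Nontrivial B]
    (hG : IsNeoliberalGroup k G) (hk : 0 < k) (hL : IsCanonicalStructure L B k G)
    {F : Set (FinStructure L)} (hF : IsBoundSet F B) (hFl : ∀ Y ∈ F, Y.1 ≤ l) {V J : Type}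
    [Finite V] {W : J → Finset V} {Φ : J → Set (V → B)} (h : IsInjectiveSystem L' k l W Φ)
    (hΦ : ∀ j, ∀ f ∈ Φ j, ∀ g ∈ G, g ∘ f ∈ Φ j)
    (horb : ∀ j (U : Finset V), U.card = k → U ⊆ W j → ∀ f ∈ Φ j, ∀ f' ∈ Φ j,
      ∃ g ∈ G, ∀ x ∈ U, f' x = g (f x)) : ∃ f : V → B, ∀ j, f ∈ Φ j := by
  classical
  obtain ⟨n, ⟨e⟩⟩ := Finite.exists_equiv_fin V
  let Rel : ∀ r, L.Relations r → Set (Fin r → V) := fun r R =>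
    {y | Function.Injective y ∧ ∃ j, (∀ i, y i ∈ W j) ∧ ∃ f ∈ Φ j, f ∘ y ∈ relOf B R}
  have hRel : ∀ {r : ℕ} (R : L.Relations r) j, ∀ f ∈ Φ j, ∀ y : Fin r → V, (∀ i, y i ∈ W j) →
      (f ∘ y ∈ relOf B R ↔ y ∈ Rel r R) := by
    intro r R j f hf y hy
    by_cases hr : r = k
    swap
    · exact ((hL.arity r hr).false R).elim
    subst hr
    refine ⟨fun hR => ⟨(hL.injective hR).of_comp, j, hy, f, hf, hR⟩, ?_⟩
    rintro ⟨hyinj, j', hy', f', hf', hR⟩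
    have hcard : (Finset.univ.image y).card = r := by
      rw [Finset.card_image_of_injective _ hyinj, Finset.card_univ, Fintype.card_fin]
    have hsub : ∀ {j}, (∀ i, y i ∈ W j) → Finset.univ.image y ⊆ W j := fun h x hx => by
      obtain ⟨i, -, rfl⟩ := Finset.mem_image.1 hx
      exact h i
    obtain ⟨f'', hf'', hff''⟩ := h.proj j' j _ hcard (hsub hy') (hsub hy) f' hf'
    obtain ⟨g, hg, hgf⟩ := horb j _ hcard (hsub hy) f'' hf'' f hf
    convert hL.smul_mem _ R g hg _ hR using 1
    ext i
    have hi : y i ∈ Finset.univ.image y := Finset.mem_image_of_mem _ (Finset.mem_univ i)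
    exact (hgf _ hi).trans (congrArg g (hff'' _ hi))
  let M : FinStructure L := ⟨n,
    { funMap := fun f => isEmptyElim f
      RelMap := fun {r} R q => e.symm ∘ q ∈ Rel r R }⟩
  -- A bound inside `M` has at most `l` points, so they lie in one scope, and any member of that
  -- constraint embeds the bound into `B`, which is impossible.
  obtain ⟨ι⟩ := (hF M).2 fun Y hY => ⟨fun ι => by
    let c : Fin Y.1 → V := fun y => e.symm (ι y)
    have hc : Function.Injective c := fun y y' hyy => ι.injective (e.symm.injective hyy)
    obtain ⟨f, hfinj, hfR⟩ : ∃ f : V → B, Function.Injective (f ∘ c) ∧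
        ∀ {r : ℕ} (R : L.Relations r) (y : Fin r → Fin Y.1),
          f ∘ c ∘ y ∈ relOf B R ↔ c ∘ y ∈ Rel r R := by
      -- Scopes are only known to cover non-empty sets, so a bound without points is treated
      -- separately.
      rcases (Finset.univ.image c).eq_empty_or_nonempty with hempty | hne
      · have hY : IsEmpty (Fin Y.1) := by
          rw [Finset.image_eq_empty, Finset.univ_eq_empty_iff] at hempty
          exact hempty
        refine ⟨fun _ => Classical.arbitrary B, fun y => hY.elim y, fun {r} R y => ?_⟩
        by_cases hr : r = k
        · exact hY.elim (y ⟨0, hr ▸ hk⟩)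
        · exact ((hL.arity r hr).false R).elim
      · obtain ⟨j, hj⟩ := h.cover _ hne (Finset.card_image_le.trans (by
          rw [Finset.card_univ, Fintype.card_fin]
          exact hFl Y hY))
        obtain ⟨f, hf⟩ := h.nonempty j
        have hcj : ∀ y, c y ∈ W j := fun y => hj (Finset.mem_image_of_mem _ (Finset.mem_univ y))
        exact ⟨f, fun y y' hyy => hc (h.injOn j f hf (hcj y) (hcj y') hyy),
          fun R y => hRel R j f hf (c ∘ y) fun i => hcj _⟩
    let ι' : Y.Carrier ↪[L] B :=
      { toFun := f ∘ c
        inj' := hfinj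
        map_fun' := fun f => isEmptyElim f
        map_rel' := fun {r} R y => (hfR R y).trans (ι.map_rel R y) }
    exact ((hF Y).1 ⟨ι'⟩ Y hY).elim (FirstOrder.Language.Embedding.refl L _)⟩
  refine ⟨fun x => ι (e x), fun j => ?_⟩
  obtain ⟨f, hf⟩ := h.nonempty j
  obtain ⟨g, hg, hgf⟩ : ∃ g ∈ G, ∀ x ∈ W j, g (f x) = ι (e x) := by
    rcases le_or_gt k (W j).card with hW | hW
    · refine hL.exists_map_eq hG (W j) hW (h.injOn j f hf) fun R y hy hR => ?_
      have : e.symm ∘ (e ∘ y) ∈ Rel k R := by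
        rw [← Function.comp_assoc, e.symm_comp_self, Function.id_comp]
        exact (hRel R j f hf y hy).1 hR
      exact (ι.map_rel R (e ∘ y)).2 this
    · exact hG.exists_map_eq (W j) (by omega) (h.injOn j f hf)
        fun x _ y _ hxy => e.injective (ι.injective hxy)
  exact h.dep j (g ∘ f) _ hgf (hΦ j f hf g hg)

theorem isPP_agree {V : Type} [Finite V] {T : Set (V → B)} (hT : IsPP L T) (U : Finset V) :
    IsPP L {h : V → B | ∃ f ∈ T, ∀ x ∈ U, h x = f x} := by
  have := ((hT.reindex (Sum.inr : V → V ⊕ V)).inter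
    (IsPP.finset_iInter U fun x _ => IsPP.eq (Sum.inl x) (Sum.inr x))).image (Sum.inl : V → V ⊕ V)
  convert this using 1
  ext h
  constructor
  · rintro ⟨f, hf, hhf⟩
    exact ⟨Sum.elim h f, ⟨hf, hhf⟩, rfl⟩
  · rintro ⟨H, ⟨hf, hhf⟩, rfl⟩
    exact ⟨_, hf, hhf⟩

/-- The orbits of the group that meet a given set of assignments. -/
def orbitsOf {V : Type} (G : Subgroup (Equiv.Perm B)) (C : Set (V → B)) :
    Set (MulAction.orbitRel.Quotient G (V → B)) :=
  Quotient.mk'' '' C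

theorem mk_mem_orbitsOf {V : Type} {C : Set (V → B)} (hC : ∀ f ∈ C, ∀ g ∈ G, g ∘ f ∈ C)
    {f : V → B} : (Quotient.mk'' f : MulAction.orbitRel.Quotient G (V → B)) ∈ orbitsOf G C ↔
      f ∈ C := by
  refine ⟨?_, fun hf => ⟨f, hf, rfl⟩⟩
  rintro ⟨f', hf', h⟩
  obtain ⟨g, hg⟩ := MulAction.orbitRel_apply.1 (Quotient.eq''.1 h.symm)
  rw [← hg]
  exact hC f' hf' g g.2

theorem IsOligomorphic.finite_quotient {V : Type} [Finite V] (hG : IsOligomorphic G) :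
    Finite (MulAction.orbitRel.Quotient G (V → B)) := by
  obtain ⟨n, ⟨e⟩⟩ := Finite.exists_equiv_fin V
  have := hG n
  refine Finite.of_surjective (Quotient.map' (s₁ := MulAction.orbitRel G (Fin n → B))
    (s₂ := MulAction.orbitRel G (V → B)) (fun f => f ∘ e) ?_) ?_
  · rintro f _ ⟨g, rfl⟩
    exact ⟨g, rfl⟩
  · intro q
    induction q using Quotient.inductionOn' with
    | h f => exact ⟨Quotient.mk'' (f ∘ e.symm), congrArg Quotient.mk'' (by ext x; simp)⟩

/-- The restriction `C` on `U` is satisfied by some but not by all members of the constraints whose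
scope contains `U`. -/
structure IsProperRestriction (L : FirstOrder.Language.{u, v}) [L.Structure B] (k : ℕ) {V J : Type}
    (W : J → Finset V) (Φ : J → Set (V → B)) (U : Finset V) (C : Set (V → B)) : Prop where
  card : U.card = k
  pp : IsPP L C
  dep : ∀ f f', (∀ x ∈ U, f x = f' x) → f ∈ C → f' ∈ C
  exists_mem : ∀ j, U ⊆ W j → ∃ f ∈ Φ j, f ∈ C
  exists_notMem : ∃ j, U ⊆ W j ∧ ∃ f ∈ Φ j, f ∉ C

variable {V J : Type} {W : J → Finset V} {Φ : J → Set (V → B)}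

theorem IsInjectiveSystem.isProperRestriction (h : IsInjectiveSystem L' k l W Φ) {U : Finset V}
    {C : Set (V → B)} (hU : U.card = k) (hC : IsPP L' C)
    (hdep : ∀ f f', (∀ x ∈ U, f x = f' x) → f ∈ C → f' ∈ C) {j : J} (hj : U ⊆ W j)
    (h₁ : ∃ f ∈ Φ j, f ∈ C) (h₂ : ∃ f ∈ Φ j, f ∉ C) : IsProperRestriction L' k W Φ U C := by
  refine ⟨hU, hC, hdep, fun j' hj' => ?_, j, hj, h₂⟩
  obtain ⟨f, hf, hfC⟩ := h₁
  obtain ⟨f', hf', hff'⟩ := h.proj j j' U hU hj hj' f hf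
  exact ⟨f', hf', hdep f f' (fun x hx => (hff' x hx).symm) hfC⟩

/-- There is a restriction that does not propagate to any other set of `k` variables. -/
theorem IsInjectiveSystem.exists_sink [Finite V]
    (hT : IsDecomposableTemplate L' k N G) (hL : IsCanonicalStructure L B k G)
    (hd : IsLocallySatisfiable L B d) (h : IsInjectiveSystem L' k l W Φ)
    (hΦ : ∀ j, IsPP L' (Φ j)) (hne : ∃ U C, IsProperRestriction L' k W Φ U C) :
    ∃ U C, IsProperRestriction L' k W Φ U C ∧ ∀ j, U ⊆ W j → ∀ U' : Finset V, U'.card = k →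
      U' ≠ U → U' ⊆ W j → ∀ f ∈ Φ j, ∃ f' ∈ Φ j, f' ∈ C ∧ ∀ x ∈ U', f x = f' x := by
  by_contra! hcon
  let P := {p : Finset V × Set (V → B) // IsProperRestriction L' k W Φ p.1 p.2}
  -- A restriction `C` that is not a sink passes through some constraint to a proper restriction on
  -- another `k`-set, namely the projection of `Φ j ∩ C`.
  have hstep : ∀ p : P, ∃ (p' : P) (j : J), p.1.1 ⊆ W j ∧ p'.1.1 ⊆ W j ∧ p'.1.1 ≠ p.1.1 ∧
      ∀ f ∈ Φ j, f ∈ p.1.2 → f ∈ p'.1.2 := by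
    rintro ⟨⟨U, C⟩, hp⟩
    obtain ⟨j, hj, U', hU', hUU', hj', f, hf, hfC⟩ := hcon U C hp
    obtain ⟨f', hf', hf'C⟩ := hp.exists_mem j hj
    refine ⟨⟨⟨U', {h | ∃ f ∈ Φ j ∩ C, ∀ x ∈ U', h x = f x}⟩, h.isProperRestriction hU'
      (isPP_agree ((hΦ j).inter hp.pp) U') ?_ hj' ⟨f', hf', f', ⟨hf', hf'C⟩, fun _ _ => rfl⟩
      ⟨f, hf, ?_⟩⟩, j, hj, hj', hUU', fun f hf hfC => ⟨f, ⟨hf, hfC⟩, fun _ _ => rfl⟩⟩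
    · rintro f₁ f₂ h₁₂ ⟨f, hf, h₁⟩
      exact ⟨f, hf, fun x hx => (h₁₂ x hx).symm.trans (h₁ x hx)⟩
    · rintro ⟨f'', ⟨hf'', hf''C⟩, hff⟩
      obtain ⟨x, hx, hxne⟩ := hfC f'' hf'' hf''C
      exact hxne (hff x hx)
  choose next J' hJ hJ' hnext himp using hstep
  obtain ⟨U₀, C₀, hp₀⟩ := hne
  let p : ℕ → P := fun t => next^[t] ⟨⟨U₀, C₀⟩, hp₀⟩
  have hp : ∀ t, p (t + 1) = next (p t) := fun t => Function.iterate_succ_apply' _ _ _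
  have hCG : ∀ q : P, ∀ f ∈ q.1.2, ∀ g ∈ G, g ∘ f ∈ q.1.2 := fun q f hf g hg =>
    hT.smul_mem q.2.pp hg hf
  have hfin := hT.neoliberal.oligomorphic.finite_quotient (V := V)
  obtain ⟨i, i', hlt, hii⟩ : ∃ i i', i < i' ∧ p i = p i' := by
    -- A restriction is a union of orbits of assignments, so only finitely many pairs of a `k`-set
    -- and a restriction exist, and the walk becomes periodic.
    obtain ⟨i, i', hii, hp⟩ := Finite.exists_ne_map_eq_of_infinite fun t : ℕ =>
      ((p t).1.1, orbitsOf G (p t).1.2)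
    have : p i = p i' := by
      refine Subtype.ext (Prod.ext (Prod.mk.inj hp).1 ?_)
      ext f
      rw [← mk_mem_orbitsOf (hCG (p i)), ← mk_mem_orbitsOf (hCG (p i')), (Prod.mk.inj hp).2]
    rcases hii.lt_or_gt with hlt | hlt
    exacts [⟨i, i', hlt, this⟩, ⟨i', i, hlt, this.symm⟩]
  have hper : ∀ t, p (i + (t + (i' - i))) = p (i + t) := by
    intro t
    induction t with
    | zero =>
      rw [add_zero, zero_add, Nat.add_sub_cancel' hlt.le, hii]
    | succ t ih =>
      rw [show i + (t + 1 + (i' - i)) = i + (t + (i' - i)) + 1 by ring, hp, ih, ← hp]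
      rfl
  have hmem : ∀ t, (∃ f ∈ Φ (J' (p t)), f ∈ (p t).1.2) ∧ ∃ f ∈ Φ (J' (p t)), f ∉ (p t).1.2 := by
    intro t
    refine ⟨(p t).2.exists_mem _ (hJ _), ?_⟩
    obtain ⟨j, hj, f, hf, hfC⟩ := (p t).2.exists_notMem
    obtain ⟨f', hf', hff'⟩ := h.proj j _ _ (p t).2.card hj (hJ (p t)) f hf
    exact ⟨f', hf', fun hf'C => hfC ((p t).2.dep f' f hff' hf'C)⟩
  have hJp : ∀ t, (p (t + 1)).1.1 ⊆ W (J' (p t)) := fun t => by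
    rw [hp]
    exact hJ' _
  refine hT.no_implication_cycle hL hd (V := V) (U := fun t => (p (i + t)).1.1)
    (Φ := fun t => Φ (J' (p (i + t)))) (C := fun t => (p (i + t)).1.2) (m := i' - i) (by omega)
    (fun t => by simp only [hper]) (fun t => by simp only [hper]) (fun t => by simp only [hper])
    (fun t => (p _).2.card) (fun t => hΦ _) ?_ ?_ (fun t => (p _).2.dep) (fun t => hCG _) ?_
    (hmem _).1 (hmem _).2 ⟨1, ?_⟩
  · intro t f hf x y hx hy hxy
    have hsub : ∀ x, x ∈ (p (i + t)).1.1 ∨ x ∈ (p (i + (t + 1))).1.1 → x ∈ W (J' (p (i + t))) := by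
      rintro x (hx | hx)
      exacts [hJ _ hx, hJp (i + t) hx]
    exact h.injOn _ f hf (hsub x hx) (hsub y hy) hxy
  · intro t f
    constructor
    · rintro ⟨f', hf', hff'⟩
      obtain ⟨f'', hf'', h''⟩ := h.proj _ (J' (p (i + (t + 1)))) _ (p (i + t + 1)).2.card (hJp _)
        (hJ _) f' hf'
      exact ⟨f'', hf'', fun x hx => (h'' x hx).trans (hff' x hx)⟩
    · rintro ⟨f', hf', hff'⟩
      obtain ⟨f'', hf'', h''⟩ := h.proj _ (J' (p (i + t))) _ (p (i + t + 1)).2.card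
        (hJ _) (hJp _) f' hf'
      exact ⟨f'', hf'', fun x hx => (h'' x hx).trans (hff' x hx)⟩
  · intro t f hf hfC
    have := himp _ f hf hfC
    rwa [← hp] at this
  · have := hnext (p i)
    rwa [← hp] at this

/-- Induction on the number of orbits in the constraints. If the orbit on some `k`-set is not
determined, a sink exists; imposing it on every scope that contains its set removes an orbit and, by
the sink property, keeps all projections to `k`-sets in agreement. -/
theorem IsInjectiveSystem.exists_solution [L.IsRelational] [Nontrivial B] [Finite V] [Finite J]
    (hT : IsDecomposableTemplate L' k N G) (hL : IsCanonicalStructure L B k G)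
    (hd : IsLocallySatisfiable L B d) {F : Set (FinStructure L)} (hF : IsBoundSet F B)
    (hFl : ∀ Y ∈ F, Y.1 ≤ l) (h : IsInjectiveSystem L' k l W Φ) (hΦ : ∀ j, IsPP L' (Φ j)) :
    ∃ f : V → B, ∀ j, f ∈ Φ j := by
  classical
  have hfin := hT.neoliberal.oligomorphic.finite_quotient (V := V)
  induction hn : {z : J × MulAction.orbitRel.Quotient G (V → B) | z.2 ∈ orbitsOf G (Φ z.1)}.ncard
    using Nat.strong_induction_on generalizing Φ with
  | _ n ih =>
  by_cases horb : ∀ j (U : Finset V), U.card = k → U ⊆ W j → ∀ f ∈ Φ j, ∀ f' ∈ Φ j,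
      ∃ g ∈ G, ∀ x ∈ U, f' x = g (f x)
  · exact h.exists_solution_of_orbits hT.neoliberal (by linarith [hT.three_le]) hL hF hFl
      (fun j f hf g hg => hT.smul_mem (hΦ j) hg hf) horb
  push Not at horb
  obtain ⟨j, U, hU, hUj, f, hf, f', hf', hff'⟩ := horb
  obtain ⟨U, C, hUC, hsink⟩ := h.exists_sink hT hL hd hΦ ⟨U, _, h.isProperRestriction hU
    (hT.orbit_on U hU f ((h.injOn j f hf).mono hUj)) (by
      rintro f₁ f₂ h₁₂ ⟨g, hg, hgf⟩
      exact ⟨g, hg, fun x hx => (h₁₂ x hx).symm.trans (hgf x hx)⟩) hUj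
    ⟨f, hf, 1, G.one_mem, fun _ _ => rfl⟩ ⟨f', hf', by
      rintro ⟨g, hg, hgf⟩
      obtain ⟨x, hx, hne⟩ := hff' g hg
      exact hne (hgf x hx)⟩⟩
  let Φ' : J → Set (V → B) := fun j => if U ⊆ W j then Φ j ∩ C else Φ j
  have hsub : ∀ j, Φ' j ⊆ Φ j := fun j f hf => by
    by_cases hj : U ⊆ W j
    · simp only [Φ', if_pos hj] at hf
      exact hf.1
    · simpa only [Φ', if_neg hj] using hf
  have hΦ' : ∀ j, IsPP L' (Φ' j) := fun j => by
    simp only [Φ']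
    split_ifs
    exacts [(hΦ j).inter hUC.pp, hΦ j]
  have hsys : IsInjectiveSystem L' k l W Φ' := by
    refine ⟨fun j f f' hff' hf => ?_, fun j => ?_, fun j f hf => h.injOn j f (hsub j hf), h.cover,
      fun j j' U' hU' hj hj' f hf => ?_⟩
    · by_cases hj : U ⊆ W j
      · simp only [Φ', if_pos hj] at hf ⊢
        exact ⟨h.dep j f f' hff' hf.1, hUC.dep f f' (fun x hx => hff' x (hj hx)) hf.2⟩
      · simp only [Φ', if_neg hj] at hf ⊢
        exact h.dep j f f' hff' hf
    · by_cases hj : U ⊆ W j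
      · simp only [Φ', if_pos hj]
        exact hUC.exists_mem j hj
      · simp only [Φ', if_neg hj]
        exact h.nonempty j
    · obtain ⟨f', hf', hff'⟩ := h.proj j j' U' hU' hj hj' f (hsub j hf)
      by_cases hjU : U ⊆ W j'
      · simp only [Φ', if_pos hjU]
        by_cases hUU : U' = U
        · subst hUU
          simp only [Φ', if_pos hj] at hf
          exact ⟨f', ⟨hf', hUC.dep f f' (fun x hx => (hff' x hx).symm) hf.2⟩, hff'⟩
        · obtain ⟨f'', hf'', hf''C, h''⟩ := hsink j' hjU U' hU' hUU hj' f' hf'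
          exact ⟨f'', ⟨hf'', hf''C⟩, fun x hx => (h'' x hx).symm.trans (hff' x hx)⟩
      · simp only [Φ', if_neg hjU]
        exact ⟨f', hf', hff'⟩
  obtain ⟨f, hf⟩ := ih _ (by
    rw [← hn]
    refine Set.ncard_lt_ncard ⟨fun z hz => Set.image_mono (hsub z.1) hz, fun hle => ?_⟩
      (Set.toFinite _)
    obtain ⟨j, hj, f, hf, hfC⟩ := hUC.exists_notMem
    have hmem : (Quotient.mk'' f : MulAction.orbitRel.Quotient G (V → B)) ∈ orbitsOf G (Φ' j) :=
      hle (show (j, _) ∈ _ from ⟨f, hf, rfl⟩)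
    rw [mk_mem_orbitsOf fun f hf g hg => hT.smul_mem (hΦ' j) hg hf] at hmem
    simp only [Φ', if_pos hj] at hmem
    exact hfC hmem.2) hsys hΦ' rfl
  exact ⟨f, fun j => hsub j (hf j)⟩

end System

/-! ### From minimal instances to injective systems -/

section Instance

variable {L : FirstOrder.Language.{u, v}} {L' : FirstOrder.Language.{u', v'}} {B : Type w}
  [L.Structure B] [L'.Structure B] {k l N d : ℕ} {G : Subgroup (Equiv.Perm B)}

/-- First-order expansions of `k`-neoliberal structures of bounded strict width are decomposable
templates. -/
theorem IsFirstOrderExpansion.exists_isDecomposableTemplate [L.IsRelational]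
    (hA : IsFirstOrderExpansion L L' B) (hG : IsNeoliberalGroup k G)
    (hL : IsCanonicalStructure L B k G) (hk : 3 ≤ k) (harity : HasBoundedArity L')
    (hwidth : HasBoundedStrictWidth L' B) : ∃ N, IsDecomposableTemplate L' k N G := by
  obtain ⟨m, -, hm⟩ := hwidth
  obtain ⟨N, hN⟩ := hm.exists_isDecomposable harity
  refine ⟨N, hG, hk, fun n R g hg f hf => ?_, fun a ha => ?_, hN⟩
  · obtain ⟨φ, hφ⟩ := Set.empty_definable_iff.1 (hA.2 n R)
    let g' : B ≃[L] B :=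
      { toEquiv := g
        map_fun' := fun f => isEmptyElim f
        map_rel' := fun {r} R x => by
          refine ⟨fun h => ?_, fun h => hL.smul_mem r R g hg x h⟩
          have h' := hL.smul_mem r R g⁻¹ (G.inv_mem hg) _ h
          have e : (g⁻¹ : Equiv.Perm B) ∘ g.toFun ∘ x = x := by
            ext i
            exact g.symm_apply_apply (x i)
          rwa [e] at h' }
    rw [hφ] at hf ⊢
    exact (FirstOrder.Language.StrongHomClass.realize_formula g' φ).2 hf
  · obtain ⟨R, hR, -⟩ := hL.named a ha
    obtain ⟨⟨e, he⟩, -⟩ := hA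
    have := IsPP.rel (A := B) (e.onRelation R) (id : Fin k → Fin k)
    convert this using 1
    ext f
    have h₁ : f ∘ id ∈ relOf B (e.onRelation R) ↔ f ∈ relOf B R :=
      Iff.of_eq (FirstOrder.Language.LHom.map_onRelation e R f)
    change _ ↔ f ∘ id ∈ relOf B (e.onRelation R)
    rw [h₁, hR]
    constructor
    · rintro ⟨g, hg, rfl⟩
      exact ⟨⟨g, hg⟩, rfl⟩
    · rintro ⟨g, rfl⟩
      exact ⟨g, g.2, rfl⟩

/-- The assignments to all variables that satisfy a constraint. -/
def CSPConstraint.assignments {V : Type} (C : CSPConstraint V B) : Set (V → B) :=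
  {f | (fun x : C.scope => f x) ∈ C.rel}

theorem CSPConstraint.mem_assignments_congr {V : Type} {C : CSPConstraint V B} {f f' : V → B}
    (h : ∀ x ∈ C.scope, f x = f' x) (hf : f ∈ C.assignments) : f' ∈ C.assignments := by
  have : (fun x : C.scope => f x) = fun x : C.scope => f' x := funext fun x => h x x.2
  change (fun x : C.scope => f' x) ∈ C.rel
  rwa [← this]

theorem CSPConstraint.exists_assignment [Nonempty B] {V : Type} (C : CSPConstraint V B)
    {f : C.scope → B} (hf : f ∈ C.rel) : ∃ f' ∈ C.assignments, ∀ x : C.scope, f' x = f x := by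
  classical
  let f' : V → B := fun x => if h : x ∈ C.scope then f ⟨x, h⟩ else Classical.arbitrary B
  have h : ∀ x : C.scope, f' x = f x := fun x => dif_pos x.2
  refine ⟨f', ?_, h⟩
  change (fun x : C.scope => f' x) ∈ C.rel
  rwa [funext h]

variable {V : Type} {I : CSPInstance V B}

theorem CSPInstance.IsOver.isPP_assignments [L'.IsRelational] (hI : I.IsOver (ppRels L' B l))
    {C : CSPConstraint V B} (hC : C ∈ I.constraints) : IsPP L' C.assignments := by
  obtain ⟨n, t, -, S, ⟨-, hS⟩, h⟩ := hI C hC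
  convert (IsPP.of_isPPDefinable hS).reindex (fun i => (t i : V)) using 1
  ext f
  exact h _

theorem CSPInstance.IsMinimal.exists_eq_on [Nonempty B] (hI : I.IsMinimal k l)
    {C D : CSPConstraint V B} (hC : C ∈ I.constraints) (hD : D ∈ I.constraints) {m : ℕ} (hm : 1 ≤ m)
    (hmk : m ≤ k) (t : Fin m → V) (htC : ∀ i, t i ∈ C.scope) (htD : ∀ i, t i ∈ D.scope) {f : V → B}
    (hf : f ∈ C.assignments) : ∃ f' ∈ D.assignments, ∀ i, f' (t i) = f (t i) := by
  have h := hI.coincide m hm hmk t C hC D hD htC htD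
  have : (fun i => f (t i)) ∈ C.proj fun i => ⟨t i, htC i⟩ := ⟨_, hf, rfl⟩
  rw [h] at this
  obtain ⟨f₀, hf₀, h₀⟩ := this
  obtain ⟨f', hf', h'⟩ := D.exists_assignment hf₀
  exact ⟨f', hf', fun i => (h' ⟨t i, htD i⟩).trans (congrFun h₀ i)⟩

/-- The variables `x` and `y` are equal in all assignments that satisfy some constraint. -/
def CSPInstance.Entails (I : CSPInstance V B) (x y : V) : Prop :=
  ∃ C ∈ I.constraints, x ∈ C.scope ∧ y ∈ C.scope ∧ ∀ f ∈ C.assignments, f x = f y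

/-- Constraints agree on pairs of variables because `2 ≤ k`, so an equality forced by one constraint
is forced by every constraint containing both variables. -/
theorem CSPInstance.IsMinimal.eq_of_entails [Nonempty B] (hI : I.IsMinimal k l) (hk : 2 ≤ k)
    {x y : V} (hxy : I.Entails x y) {C : CSPConstraint V B} (hC : C ∈ I.constraints)
    (hx : x ∈ C.scope) (hy : y ∈ C.scope) {f : V → B} (hf : f ∈ C.assignments) : f x = f y := by
  obtain ⟨D, hD, hxD, hyD, h⟩ := hxy
  obtain ⟨f', hf', hff'⟩ := hI.exists_eq_on hC hD one_le_two hk ![x, y]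
    (by simp [Fin.forall_fin_two, hx, hy]) (by simp [Fin.forall_fin_two, hxD, hyD]) hf
  have h₀ := hff' 0
  have h₁ := hff' 1
  simp only [Matrix.cons_val_zero, Matrix.cons_val_one] at h₀ h₁
  rw [← h₀, ← h₁, h f' hf']

/-- Entailed equality is an equivalence relation. -/
def CSPInstance.IsMinimal.setoid [Nonempty B] (hI : I.IsMinimal k l) (hk : 2 ≤ k) (hl : 3 ≤ l) :
    Setoid V where
  r := I.Entails
  iseqv :=
    { refl := fun x => by
        obtain ⟨C, hC, hx⟩ := hI.covered 1 le_rfl (by omega) fun _ => x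
        exact ⟨C, hC, hx 0, hx 0, fun _ _ => rfl⟩
      symm := fun ⟨C, hC, hx, hy, h⟩ => ⟨C, hC, hy, hx, fun f hf => (h f hf).symm⟩
      trans := fun {x y z} hxy hyz => by
        obtain ⟨C, hC, h⟩ := hI.covered 3 (by omega) hl ![x, y, z]
        have hx : x ∈ C.scope := h 0
        have hy : y ∈ C.scope := h 1
        have hz : z ∈ C.scope := h 2
        exact ⟨C, hC, hx, hz, fun f hf => (hI.eq_of_entails hk hxy hC hx hy hf).trans
          (hI.eq_of_entails hk hyz hC hy hz hf)⟩ }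

/-- Variables can be replaced by variables that are entailed to be equal, without changing the
values. -/
theorem CSPInstance.IsMinimal.exists_eq_on_of_entails [Nonempty B] (hI : I.IsMinimal k l)
    (hk : 2 ≤ k) (hl : k + 1 ≤ l) {C D : CSPConstraint V B} (hC : C ∈ I.constraints)
    (hD : D ∈ I.constraints) {x y : Fin k → V} (hx : ∀ i, x i ∈ C.scope) (hy : ∀ i, y i ∈ D.scope)
    (hxy : ∀ i, I.Entails (x i) (y i)) {f : V → B} (hf : f ∈ C.assignments) :
    ∃ f' ∈ D.assignments, ∀ i, f' (y i) = f (x i) := by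
  -- The variables are replaced one at a time. Each replacement needs a scope containing the current
  -- `k` variables and the next `y`, which is the reason for `k + 1 ≤ l`.
  have key : ∀ r ≤ k, ∃ E ∈ I.constraints, ∃ f' ∈ E.assignments, ∀ i : Fin k,
      (if i.1 < r then y i else x i) ∈ E.scope ∧ f' (if i.1 < r then y i else x i) = f (x i) := by
    intro r hr
    induction r with
    | zero => exact ⟨C, hC, f, hf, fun i => by simp [hx i]⟩
    | succ r ih =>
      obtain ⟨E, hE, f', hf', h⟩ := ih (by omega)
      let z : Fin k → V := fun i => if i.1 < r then y i else x i
      let ir : Fin k := ⟨r, hr⟩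
      obtain ⟨E', hE', hz⟩ := hI.covered (k + 1) (by omega) hl (Fin.snoc z (y ir) : Fin (k + 1) → V)
      have hzE' : ∀ i, z i ∈ E'.scope := fun i => by simpa using hz i.castSucc
      have hyE' : y ir ∈ E'.scope := by simpa using hz (Fin.last k)
      obtain ⟨f'', hf'', h''⟩ := hI.exists_eq_on hE hE' (by omega) le_rfl z (fun i => (h i).1) hzE'
        hf'
      have hzr : z ir = x ir := by simp [z, ir]
      refine ⟨E', hE', f'', hf'', fun i => ?_⟩
      by_cases hi : i = ir
      · subst hi
        have hlt : ir.1 < r + 1 := Nat.lt_succ_self r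
        rw [if_pos hlt]
        refine ⟨hyE', ?_⟩
        rw [← hI.eq_of_entails hk (hxy ir) hE' (hzr ▸ hzE' ir) hyE' hf'', ← hzr, h'' ir, hzr]
        have := (h ir).2
        rwa [← show z ir = if ir.1 < r then y ir else x ir from rfl, hzr] at this
      · have hne : i.1 ≠ r := fun h => hi (Fin.ext h)
        have hiff : i.1 < r + 1 ↔ i.1 < r := by omega
        simp only [hiff]
        exact ⟨hzE' i, (h'' i).trans (h i).2⟩
  obtain ⟨E, hE, f', hf', h⟩ := key k le_rfl
  simp only [Fin.is_lt, if_true] at h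
  obtain ⟨f'', hf'', h''⟩ := hI.exists_eq_on hE hD (by omega) le_rfl y (fun i => (h i).1) hy hf'
  exact ⟨f'', hf'', fun i => (h'' i).trans (h i).2⟩

/-- Entailed equalities are factored out, and distinct classes within a scope are required to take
distinct values. `exists_generic` keeps the constraints non-empty, and `exists_generic_extend` keeps
their projections to `k`-sets in agreement. -/
theorem CSPInstance.IsMinimal.exists_solution [L.IsRelational] [L'.IsRelational] [Nontrivial B]
    [Finite V] (hT : IsDecomposableTemplate L' k N G) (hL : IsCanonicalStructure L B k G)
    (hd : IsLocallySatisfiable L B d) {F : Set (FinStructure L)} (hF : IsBoundSet F B)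
    (hFl : ∀ Y ∈ F, Y.1 ≤ l) (hkl : k + 1 ≤ l) (hI : I.IsMinimal k l)
    (hover : I.IsOver (ppRels L' B l)) (hne : I.IsNontrivial) : ∃ f : V → B, I.IsSolution f := by
  classical
  have := Fintype.ofFinite V
  have hk := hT.three_le
  let s : Setoid V := hI.setoid (by omega) (by omega)
  let q : V → Quotient s := Quotient.mk s
  have hq : ∀ {x y}, q x = q y ↔ I.Entails x y := Quotient.eq
  let J : Type w := {C // C ∈ I.constraints}
  have hJ : Finite J := I.finite
  obtain ⟨n, ⟨eJ⟩⟩ := Finite.exists_equiv_fin J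
  let c : Fin n → CSPConstraint V B := fun j => (eJ.symm j).1
  have hc : ∀ j, c j ∈ I.constraints := fun j => (eJ.symm j).2
  let W : Fin n → Finset (Quotient s) := fun j =>
    (Finset.univ.filter fun x => x ∈ (c j).scope).image q
  have hW : ∀ {j a}, a ∈ W j ↔ ∃ x ∈ (c j).scope, q x = a := fun {j a} => by simp [W]
  let Φ : Fin n → Set (Quotient s → B) := fun j =>
    {f | f ∘ q ∈ (c j).assignments} ∩ {f | ∀ p ∈ (W j ×ˢ W j).filter fun p => p.1 ≠ p.2,
      f ∈ {f : Quotient s → B | f p.1 ≠ f p.2}}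
  have hΦ : ∀ j, IsPP L' (Φ j) := fun j => ((hover.isPP_assignments (hc j)).reindex q).inter
    (IsPP.finset_iInter _ fun p _ => hT.ne _ _)
  have hlift : ∀ j, ∀ f ∈ (c j).assignments,
      (∀ x y, (∃ g ∈ (c j).assignments, g x ≠ g y) → f x ≠ f y) →
      ∃ f' ∈ Φ j, ∀ x ∈ (c j).scope, f' (q x) = f x := by
    intro j f hf hgen
    have h : ∀ a ∈ W j, ∃ b, ∀ x ∈ (c j).scope, q x = a → b = f x := by
      intro a ha
      obtain ⟨x, hx, rfl⟩ := hW.1 ha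
      exact ⟨f x, fun y hy hxy => hI.eq_of_entails (by omega) (hq.1 hxy.symm) (hc j) hx hy hf⟩
    choose! f' hf' using h
    have hf'q : ∀ x ∈ (c j).scope, f' (q x) = f x := fun x hx =>
      hf' (q x) (hW.2 ⟨x, hx, rfl⟩) x hx rfl
    refine ⟨f', ⟨CSPConstraint.mem_assignments_congr (fun x hx => (hf'q x hx).symm) hf, ?_⟩, hf'q⟩
    rintro ⟨a, b⟩ hab
    obtain ⟨hab, hne⟩ := Finset.mem_filter.1 hab
    obtain ⟨ha, hb⟩ := Finset.mem_product.1 hab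
    obtain ⟨x, hx, rfl⟩ := hW.1 ha
    obtain ⟨y, hy, rfl⟩ := hW.1 hb
    change f' (q x) ≠ f' (q y)
    rw [hf'q x hx, hf'q y hy]
    refine hgen x y ?_
    by_contra! hcon
    exact hne (hq.2 ⟨c j, hc j, hx, hy, hcon⟩)
  have hΦinj : ∀ j, ∀ f ∈ Φ j, Set.InjOn f (W j) := by
    intro j f hf a ha b hb hab
    by_contra hne
    exact hf.2 (a, b) (Finset.mem_filter.2 ⟨Finset.mem_product.2 ⟨ha, hb⟩, hne⟩) hab
  have hsys : IsInjectiveSystem L' k l W Φ := by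
    refine ⟨fun j f f' hff' hf => ⟨?_, ?_⟩, fun j => ?_, hΦinj, fun X hX hXl => ?_,
      fun j j' U hU hj hj' f hf => ?_⟩
    · exact CSPConstraint.mem_assignments_congr (fun x hx => hff' _ (hW.2 ⟨x, hx, rfl⟩)) hf.1
    · intro p hp
      obtain ⟨h₁, h₂⟩ := Finset.mem_product.1 (Finset.mem_filter.1 hp).1
      have := hf.2 p hp
      change f p.1 ≠ f p.2 at this
      rwa [hff' _ h₁, hff' _ h₂] at this
    · obtain ⟨f₀, hf₀⟩ := hne (c j) (hc j)
      obtain ⟨f, hf, -⟩ := (c j).exists_assignment hf₀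
      obtain ⟨f, hf, hgen⟩ := hT.exists_generic (hover.isPP_assignments (hc j)) ⟨f, hf⟩
      obtain ⟨f', hf', -⟩ := hlift j f hf hgen
      exact ⟨f', hf'⟩
    · obtain ⟨C, hC, hX⟩ := hI.covered X.card (Finset.card_pos.2 hX) hXl
        fun i => (X.equivFin.symm i).1.out
      refine ⟨eJ ⟨C, hC⟩, fun a ha => hW.2 ⟨a.out, ?_, Quotient.out_eq a⟩⟩
      have := hX (X.equivFin ⟨a, ha⟩)
      rw [Equiv.symm_apply_apply] at this
      simpa [c] using this
    · let e : Fin k ≃ U := (U.equivFinOfCardEq hU).symm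
      choose x hx hxe using fun i => hW.1 (hj (e i).2)
      choose y hy hye using fun i => hW.1 (hj' (e i).2)
      obtain ⟨f₁, hf₁, h₁⟩ := hI.exists_eq_on_of_entails (by omega) hkl (hc j) (hc j') hx hy
        (fun i => hq.1 ((hxe i).trans (hye i).symm)) hf.1
      have h₁' : ∀ i, f₁ (y i) = f (e i) := fun i => (h₁ i).trans (congrArg f (hxe i))
      -- The transferred assignment `f₁` takes the values of `f` on `U`, but may identify other
      -- classes. As it is injective on the `k` representatives, the unwanted equalities can be
      -- removed without changing these values.
      have hyinj : Function.Injective y := fun i i' h =>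
        e.injective (Subtype.ext ((hye i).symm.trans ((congrArg q h).trans (hye i'))))
      obtain ⟨f₂, hf₂, h₂, hgen⟩ := hT.exists_generic_extend (hover.isPP_assignments (hc j'))
        (Finset.univ.image y) (by
          rw [Finset.card_image_of_injective _ hyinj, Finset.card_univ, Fintype.card_fin]) hf₁ (by
          intro a ha b hb hab
          obtain ⟨i, -, rfl⟩ := Finset.mem_image.1 (Finset.mem_coe.1 ha)
          obtain ⟨i', -, rfl⟩ := Finset.mem_image.1 (Finset.mem_coe.1 hb)
          rw [h₁', h₁'] at hab
          exact congrArg y (e.injective (Subtype.ext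
            (hΦinj j f hf (hj (e i).2) (hj (e i').2) hab))))
      obtain ⟨f₃, hf₃, h₃⟩ := hlift j' f₂ hf₂ hgen
      refine ⟨f₃, hf₃, fun a ha => ?_⟩
      obtain ⟨i, hi⟩ := e.surjective ⟨a, ha⟩
      have hia : (e i : Quotient s) = a := congrArg Subtype.val hi
      rw [← hia, ← hye i, h₃ _ (hy i), h₂ _ (Finset.mem_image_of_mem _ (Finset.mem_univ i)), h₁',
        hye i]
  obtain ⟨f, hf⟩ := hsys.exists_solution hT hL hd hF hFl hΦ
  refine ⟨f ∘ q, fun C hC => ?_⟩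
  have h := (hf (eJ ⟨C, hC⟩)).1
  have hcC : c (eJ ⟨C, hC⟩) = C := congrArg Subtype.val (eJ.symm_apply_apply ⟨C, hC⟩)
  change f ∘ q ∈ (c (eJ ⟨C, hC⟩)).assignments at h
  rwa [hcC] at h

theorem CSPInstance.IsMinimal.exists_solution_of_subsingleton [Subsingleton B]
    (hI : I.IsMinimal k l) (hl : 1 ≤ l) (hne : I.IsNontrivial) : ∃ f : V → B, I.IsSolution f := by
  have hB : Nonempty (V → B) := by
    rcases isEmpty_or_nonempty V with hV | ⟨⟨x⟩⟩
    · exact ⟨fun x => hV.elim x⟩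
    · obtain ⟨C, hC, hx⟩ := hI.covered 1 le_rfl hl fun _ => x
      obtain ⟨f, -⟩ := hne C hC
      exact ⟨fun _ => f ⟨x, hx 0⟩⟩
  obtain ⟨f⟩ := hB
  refine ⟨f, fun C hC => ?_⟩
  obtain ⟨f', hf'⟩ := hne C hC
  rwa [Subsingleton.elim (fun x : C.scope => f x) f']

end Instance

theorem corollary2 {L : FirstOrder.Language.{u, v}} {L' : FirstOrder.Language.{u', v'}} [L.IsRelational]
    [L'.IsRelational] {B : Type w} [L.Structure B] [L'.Structure B] (k : ℕ) (hk : 3 ≤ k)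
    (hB : IsNeoliberal L B k) (hdual : HasFiniteDuality L B)
    (hA : IsFirstOrderExpansion L L' B) (harity : HasBoundedArity L')
    (hwidth : HasBoundedStrictWidth L' B) :
    HasRelationalWidth L' B k (max (k + 1) (boundSize L B)) := by
  obtain ⟨G, hG, hL⟩ := hB
  obtain ⟨⟨F, hF, hFB⟩, hobs⟩ := hdual
  intro V _ I hI hne
  -- With at most one point there are no injective `k`-tuples to work with, but any assignment
  -- satisfies all non-empty constraints.
  rcases subsingleton_or_nontrivial B with hsub | hnt
  · exact hI.2.1.exists_solution_of_subsingleton (by omega) hne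
  obtain ⟨N, hT⟩ := hA.exists_isDecomposableTemplate hG hL hk harity hwidth
  obtain ⟨d, hd⟩ := exists_isLocallySatisfiable hobs
  obtain ⟨b, hb⟩ := (hF.image fun Y => Y.1).bddAbove
  -- Finite boundedness makes the set of admissible sizes non-empty, so its infimum `boundSize` is
  -- attained by a set of bounds.
  obtain ⟨F', -, hF', hF'b⟩ := Nat.sInf_mem (s := {b : ℕ | ∃ F : Set (FinStructure L), F.Finite ∧
    IsBoundSet F B ∧ ∀ Y ∈ F, Y.1 ≤ b}) ⟨b, F, hF, hFB, fun Y hY => hb ⟨Y, hY, rfl⟩⟩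
  exact hI.2.1.exists_solution hT hL hd hF' (fun Y hY => (hF'b Y hY).trans (le_max_right _ _))
    (le_max_left _ _) hI.1 hne
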